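/- **Theorem 4.4 (Joint convexity of relative entropy).** Let $\mathcal V$ be a Euclidean Jordan algebra, that is, a finite-dimensional real inner product space with a commutative bilinear product $\circ$ with unit $u$ satisfying $x^2\circ(x\circ y)=x\circ(x^2\circ y)$ and $\langle x\circ y,z\rangle=\langle x,y\circ z\rangle$. Put $\mathrm{tr}\,x:=\langle x,u\rangle$. A state is an element $\rho\in\{x\circ x\mid x\in\mathcal V\}$ with $\mathrm{tr}\,\rho=1$. Every $x\in\mathcal V$ has a unique spectral decomposition $x=\sum_j\lambda_jc_j$ with distinct real $\lambda_j$ and nonzero idempotents $c_j$ such that $c_j\circ c_l=0$ for $j\ne l$ and $\sum_jc_j=u$; put $\log x:=\sum_j(\log\lambda_j)c_j$. For states $\rho,\sigma$ the relative entropy is $$D(\rho\|\sigma):=\mathrm{tr}\bigl(\rho\circ\log\rho-\rho\circ\log\sigma\bigr)\in(-\infty,\infty],$$ where an eigenvalue $0$ contributes $0$ to $\log\rho$ and $\log\sigma$, and $D(\rho\|\sigma):=\infty$ if $\sigma$ has the eigenvalue $0$, with idempotent $c_0$, and $\mathrm{tr}(\rho\circ c_0)\neq0$ (that is, if the support of $\rho$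 is not contained in that of $\sigma$). Let $\rho_i,\sigma_i$ $(i=1,\dots,k)$ be states in $\mathcal V$ and let $\{p_i\}_{i=1}^k$ be a probability distribution. Then, with $0\cdot\infty:=0$, $$\sum_{i=1}^k p_i\,D(\rho_i\|\sigma_i)\;\ge\; D\Bigl(\sum_{i=1}^k p_i\rho_i\Big\|\sum_{i=1}^k p_i\sigma_i\Bigr).$$ -/

import Mathlib

/-- A (unital) Euclidean Jordan algebra: a finite-dimensional real inner product space `V` with a
commutative bilinear product `*` (the Jordan product) with unit `1`, satisfying the Jordan identity
(`IsCommJordan`), and such that `⟪x * y, z⟫ = ⟪x, y * z⟫`. The product need not be associative.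
No normalization of the inner product is imposed; the one giving every primitive idempotent the trace
`1` is a special case. -/
class EuclideanJordanAlgebra (V : Type*) extends NonAssocCommRing V, NormedAddCommGroup V,
    InnerProductSpace ℝ V, IsCommJordan V, IsScalarTower ℝ V V, FiniteDimensional ℝ V where
  inner_mul_assoc : ∀ x y z : V, Inner.inner ℝ (x * y) z = Inner.inner ℝ x (y * z)

namespace EuclideanJordanAlgebra

variable {V : Type*} [EuclideanJordanAlgebra V]

/-- The trace `tr x = ⟪x, 1⟫`. -/
noncomputable def tr (x : V) : ℝ := inner ℝ x 1

/-- The positive cone: the set of squares. -/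
def positiveCone (V : Type*) [EuclideanJordanAlgebra V] : Set V := {x | ∃ y : V, x = y * y}

/-- States: elements of the positive cone of trace one. -/
def IsState (ρ : V) : Prop := ρ ∈ positiveCone V ∧ tr ρ = 1

/-- `c` is a spectral decomposition of `x`: its support is a finite set of distinct reals (the
eigenvalues of `x`), the elements `c t` with `t` in the support are nonzero pairwise orthogonal
idempotents that sum to the unit, and `x = ∑ t • c t`. By the spectral theorem every `x` has
exactly one spectral decomposition. -/
structure IsSpectralDecomposition (x : V) (c : ℝ →₀ V) : Prop where
  idempotent : ∀ t, c t * c t = c t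
  orthogonal : ∀ s t, s ≠ t → c s * c t = 0
  complete : c.sum (fun _ e => e) = 1
  eq_sum : x = c.sum (fun t e => t • e)

open Classical in
/-- The spectral decomposition of `x`. -/
noncomputable def spectral (x : V) : ℝ →₀ V :=
  if h : ∃ c : ℝ →₀ V, IsSpectralDecomposition x c then h.choose else 0

/-- Functional calculus: `f(x) = ∑ f(t) • c_t`, where `x = ∑ t • c_t` is the spectral
decomposition. -/
noncomputable def funCalc (f : ℝ → ℝ) (x : V) : V := (spectral x).sum (fun t e => f t • e)

/-- The logarithm `log x = ∑ log t • c_t`. On the positive cone the eigenvalue `0`, if it occurs,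
contributes `0` (as `Real.log 0 = 0`), so that `x * log x` follows the convention
`0 log 0 = 0`. -/
noncomputable def log (x : V) : V := funCalc Real.log x

open Classical in
/-- The relative entropy `D(ρ‖σ) = tr (ρ ∘ log ρ - ρ ∘ log σ)`. For `σ` without the eigenvalue `0`
(so that `log σ` is defined in the strict sense) the condition below holds trivially, because
`spectral σ 0 = 0`. In general, `spectral σ 0` is the idempotent of the kernel of `σ`, and
`D(ρ‖σ) = ∞` unless the support of `ρ` is contained in that of `σ`, that is, unless `ρ` gives the
kernel of `σ` weight zero. -/
noncomputable def relEntropy (ρ σ : V) : EReal :=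
  if tr (ρ * spectral σ 0) = 0 then ((tr (ρ * log ρ - ρ * log σ) : ℝ) : EReal) else ⊤

end EuclideanJordanAlgebra

/-! Write η(t) = t log t - t. The finite relative entropy is an iterated limit of the mixed
differences `etaDiff Z h σ ρ` of tr η along σ + zρ: subtract h log Z tr ρ, which is linear in ρ, let
Z → ∞, then divide by h and let h → 0. Hence joint convexity of `etaDiff` suffices.

This convexity is read off from `etaDiff_eq_lintegral`, which says etaDiff Z h A B = ∫₀^∞ k(c) tr (A
- cB)₋ dc with a weight k ≥ 0 depending only on Z and h. Indeed A - cB is linear in (A, B), and tr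
(·)₋ is convex by Klein's inequality (`trNeg_sum_le`).

To obtain the formula, replace A by A + r1 and differentiate in r, which turns η into log. A
congruence P with P B = 1 shifts tr log by a constant (`trFun_log_flow`), and the constants cancel
in the mixed difference. What remains is the trace of the scalar function `logKernel` at P(A + r1),
a superposition over c of the traces of its spectral parts below c. By Sylvester's law
(`trFun_sign_flow`) these are the traces of the negative spectral parts of A - cB + r1, and
integrating over r > 0 gives tr (A - cB)₋.

The congruences are exp(2 L_a), with L_a the multiplication by a. Along this flow tr f(y) has
derivative 2⟨y f'(y), a⟩. For f = log the factor t f'(t) is 1, and for f = arctan(n ·) it is bounded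
and tends to 0, which yields both invariance statements. Elements on the boundary of the cone are
reached by adding ε1. -/

open Filter Topology MeasureTheory

namespace EuclideanJordanAlgebra

/-! ### Jordan identities, the spectral theorem and functional calculus. -/

section Algebra

variable {V : Type*} [EuclideanJordanAlgebra V]

instance instSMulCommClassReal : SMulCommClass ℝ V V where
  smul_comm r x y := by
    simp only [smul_eq_mul]
    rw [mul_comm x (r • y), smul_mul_assoc, mul_comm x y]

lemma inner_mul_left (a x y : V) : inner ℝ (a * x) y = inner ℝ x (a * y) := by
  rw [mul_comm, inner_mul_assoc]

lemma tr_mul (x y : V) : tr (x * y) = inner ℝ x y := by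
  rw [tr, inner_mul_assoc, mul_one]

lemma tr_idempotent {e : V} (he : e * e = e) : tr e = ‖e‖ ^ 2 := by
  rw [← real_inner_self_eq_norm_sq, ← tr_mul, he]

lemma tr_idempotent_nonneg {e : V} (he : e * e = e) : 0 ≤ tr e := by
  rw [tr_idempotent he]; positivity

/-- The fully linearized Jordan identity. -/
lemma jordan_linearized (a b c d : V) :
    a * ((b * c) * d) - (b * c) * (a * d) + (b * ((c * a) * d) - (c * a) * (b * d)) +
      (c * ((a * b) * d) - (a * b) * (c * d)) = 0 := by
  have h := two_nsmul_lie_lmul_lmul_add_add_eq_zero a b c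
  have h2 := DFunLike.congr_fun h d
  have h3 : (2 : ℝ) • (a * ((b * c) * d) - (b * c) * (a * d) +
      (b * ((c * a) * d) - (c * a) * (b * d)) +
      (c * ((a * b) * d) - (a * b) * (c * d))) = 0 := by
    rw [two_smul, ← two_nsmul]
    exact h2
  exact (smul_eq_zero.mp h3).resolve_left two_ne_zero

/-- The cubic equation satisfied by the multiplication by an idempotent. -/
lemma peirce_cubic {e : V} (he : e * e = e) (d : V) :
    (2 : ℝ) • (e * (e * (e * d))) - (3 : ℝ) • (e * (e * d)) + e * d = 0 := by
  have h := jordan_linearized e e d e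
  rw [he, mul_comm d e, mul_comm (e * d) e, he, mul_comm d e] at h
  rw [← h]
  module

/-- By `peirce_cubic` the symmetric operator L = L_e satisfies L(2L - 1)(L - 1) = 0, so its
eigenvalues lie in {0, 1/2, 1}. -/
lemma inner_mul_self_nonneg {e : V} (he : e * e = e) (x : V) : 0 ≤ inner ℝ (e * x) x := by
  have h := peirce_cubic he x
  have h1 := congrArg (fun v => inner ℝ v x) h
  have h2 := congrArg (fun v => inner ℝ v (e * x)) h
  simp only [inner_add_left, inner_sub_left, inner_smul_left, inner_zero_left, conj_trivial] at h1 h2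
  have e1 : inner ℝ (e * (e * (e * x))) x = inner ℝ (e * (e * x)) (e * x) := inner_mul_left _ _ _
  have e2 : inner ℝ (e * (e * x)) x = inner ℝ (e * x) (e * x) := inner_mul_left _ _ _
  have e3 : inner ℝ (e * (e * (e * x))) (e * x) = inner ℝ (e * (e * x)) (e * (e * x)) :=
    inner_mul_left _ _ _
  -- Modulo the cubic equation, L = (2L² - L)² + 8(L² - L)², a sum of squares of symmetric
  -- operators.
  have p1 : 0 ≤ inner ℝ ((2 : ℝ) • (e * (e * x)) - e * x) ((2 : ℝ) • (e * (e * x)) - e * x) :=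
    real_inner_self_nonneg
  have p2 : 0 ≤ inner ℝ (e * (e * x) - e * x) (e * (e * x) - e * x) := real_inner_self_nonneg
  simp only [inner_sub_left, inner_sub_right, inner_smul_left, inner_smul_right, conj_trivial,
    real_inner_comm (e * (e * x)) (e * x)] at p1 p2
  linarith

/-- Idempotents have nonnegative inner products. -/
lemma inner_idempotent_nonneg {e q : V} (he : e * e = e) (hq : q * q = q) :
    0 ≤ inner ℝ e q := by
  have h := inner_mul_self_nonneg he q
  rwa [inner_mul_assoc, hq] at h

/-- Expresses multiplication by x(xy) through operators already known to commute with those of x and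
x². This makes `operatorCommutant` stable under multiplication by x. -/
lemma mulLeft_mul_mul_self (x y : V) :
    LinearMap.mulLeft ℝ (x * (x * y)) =
      (2 : ℝ) • (LinearMap.mulLeft ℝ (x * y) * LinearMap.mulLeft ℝ x) +
        LinearMap.mulLeft ℝ (x * x) * LinearMap.mulLeft ℝ y -
        LinearMap.mulLeft ℝ y * (LinearMap.mulLeft ℝ x * LinearMap.mulLeft ℝ x) -
        LinearMap.mulLeft ℝ x * (LinearMap.mulLeft ℝ x * LinearMap.mulLeft ℝ y) := by
  ext c
  have h := jordan_linearized y x c x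
  simp only [LinearMap.sub_apply, LinearMap.add_apply, LinearMap.smul_apply,
    Module.End.mul_apply, LinearMap.mulLeft_apply]
  rw [mul_comm y x, mul_comm (x * c) x, mul_comm (x * c) (x * y), mul_comm (c * y) x, mul_comm c y,
    mul_comm (y * c) (x * x), mul_comm (x * y) x, mul_comm c (x * (x * y)), mul_comm c x] at h
  rw [← sub_eq_zero, ← h]
  module

/-- The elements `y` such that `y` and `x * y` operator commute with `x` and `x * x`. -/
def operatorCommutant (x : V) : Submodule ℝ V where
  carrier := {y | (Commute (LinearMap.mulLeft ℝ x) (LinearMap.mulLeft ℝ y) ∧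
    Commute (LinearMap.mulLeft ℝ (x * x)) (LinearMap.mulLeft ℝ y)) ∧
    (Commute (LinearMap.mulLeft ℝ x) (LinearMap.mulLeft ℝ (x * y)) ∧
    Commute (LinearMap.mulLeft ℝ (x * x)) (LinearMap.mulLeft ℝ (x * y)))}
  add_mem' := by
    rintro a b ⟨⟨h1, h2⟩, h3, h4⟩ ⟨⟨k1, k2⟩, k3, k4⟩
    have e : ∀ a b : V, LinearMap.mulLeft ℝ (a + b) =
      LinearMap.mulLeft ℝ a + LinearMap.mulLeft ℝ b := fun a b => by ext; simp [add_mul]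
    simp only [Set.mem_ofPred_eq, mul_add, e]
    exact ⟨⟨h1.add_right k1, h2.add_right k2⟩, h3.add_right k3, h4.add_right k4⟩
  zero_mem' := by
    have e : LinearMap.mulLeft ℝ (0 : V) = 0 := by ext; simp
    simp only [Set.mem_ofPred_eq, mul_zero, e]
    simp
  smul_mem' := by
    rintro r a ⟨⟨h1, h2⟩, h3, h4⟩
    have e : ∀ a : V, LinearMap.mulLeft ℝ (r • a) = r • LinearMap.mulLeft ℝ a :=
      fun a => by ext; simp [smul_mul_assoc]
    simp only [Set.mem_ofPred_eq, mul_smul_comm, e]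
    exact ⟨⟨h1.smul_right r, h2.smul_right r⟩, h3.smul_right r, h4.smul_right r⟩

lemma commute_mulLeft_sq (x : V) :
    Commute (LinearMap.mulLeft ℝ x) (LinearMap.mulLeft ℝ (x * x)) := by
  ext d
  exact (IsJordan.lmul_lmul_comm_lmul x d).symm

lemma one_mem_operatorCommutant (x : V) : (1 : V) ∈ operatorCommutant x := by
  have e : LinearMap.mulLeft ℝ (1 : V) = 1 := by ext; simp
  refine ⟨?_, ?_⟩
  · rw [e]; exact ⟨Commute.one_right _, Commute.one_right _⟩
  · rw [mul_one]; exact ⟨Commute.refl _, (commute_mulLeft_sq x).symm⟩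

lemma mul_mem_operatorCommutant {x y : V} (hy : y ∈ operatorCommutant x) :
    x * y ∈ operatorCommutant x := by
  obtain ⟨⟨h1, h2⟩, h3, h4⟩ := hy
  have hx := commute_mulLeft_sq x
  refine ⟨⟨h3, h4⟩, ?_⟩
  rw [mulLeft_mul_mul_self]
  have r := Commute.refl (LinearMap.mulLeft ℝ x)
  have r2 := Commute.refl (LinearMap.mulLeft ℝ (x * x))
  exact ⟨((((h3.mul_right r).smul_right _).add_right (hx.mul_right h1)).sub_right
      (h1.mul_right (r.mul_right r))).sub_right (r.mul_right (r.mul_right h1)),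
    ((((h4.mul_right hx.symm).smul_right _).add_right (r2.mul_right h2)).sub_right
      (h2.mul_right (hx.symm.mul_right hx.symm))).sub_right
      (hx.symm.mul_right (hx.symm.mul_right h2))⟩

lemma mulLeft_isSymmetric (x : V) : (LinearMap.mulLeft ℝ x).IsSymmetric := fun a b => by
  simpa using inner_mul_left x a b

/-- The spectral theorem. -/
theorem exists_isSpectralDecomposition (x : V) : ∃ c : ℝ →₀ V, IsSpectralDecomposition x c := by
  classical
  have hW : ∀ y ∈ operatorCommutant x, LinearMap.mulLeft ℝ x y ∈ operatorCommutant x :=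
    fun y hy => mul_mem_operatorCommutant hy
  -- Diagonalize multiplication by x on the commutant only, and split 1 into eigenvectors there: the
  -- components then operator commute with x.
  have hs := (mulLeft_isSymmetric x).restrict_invariant hW
  have htop := Submodule.orthogonal_eq_bot_iff.mp hs.orthogonalComplement_iSup_eigenspaces_eq_bot
  have h1 : (⟨1, one_mem_operatorCommutant x⟩ : operatorCommutant x) ∈
      ⨆ μ, Module.End.eigenspace ((LinearMap.mulLeft ℝ x).restrict hW) μ := by
    rw [htop]; trivial
  obtain ⟨f, hf, hsum⟩ := (Submodule.mem_iSup_iff_exists_finsupp _ _).mp h1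
  have hx : ∀ t, x * (f t : V) = t • (f t : V) := fun t => by
    have := Module.End.mem_eigenspace_iff.mp (hf t)
    exact congrArg Subtype.val this
  have hcomm : ∀ t (d : V), x * ((f t : V) * d) = (f t : V) * (x * d) := fun t d =>
    LinearMap.congr_fun (f t).2.1.1 d
  have hsum' : ∑ t ∈ f.support, (f t : V) = 1 := by
    have := congrArg Subtype.val hsum
    simpa [Finsupp.sum] using this
  -- Operator commutation makes f s * f t an eigenvector of x for both s and t, hence zero.
  have horth : ∀ s t, s ≠ t → (f s : V) * (f t : V) = 0 := fun s t hst => by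
    have a1 := hcomm s (f t : V)
    have a2 := hcomm t (f s : V)
    rw [hx, mul_smul_comm] at a1 a2
    rw [mul_comm (f t : V)] at a2
    have : (s - t) • ((f s : V) * (f t : V)) = 0 := by rw [sub_smul, ← a1, ← a2, sub_self]
    exact (smul_eq_zero.mp this).resolve_left (sub_ne_zero.mpr hst)
  have hid : ∀ t, (f t : V) * (f t : V) = f t := fun t => by
    by_cases ht : t ∈ f.support
    · conv_rhs => rw [← mul_one (f t : V), ← hsum', Finset.mul_sum]
      rw [Finset.sum_eq_single t (fun s _ hs => horth t s hs.symm) (fun h => absurd ht h)]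
    · simp [Finsupp.notMem_support_iff.mp ht]
  refine ⟨f.mapRange Subtype.val rfl, ?_, ?_, ?_, ?_⟩
  · intro t; simpa using hid t
  · intro s t hst; simpa using horth s t hst
  · rw [Finsupp.sum_mapRange_index (by simp)]; exact hsum'
  · rw [Finsupp.sum_mapRange_index (by simp), Finsupp.sum]
    simp_rw [← hx]
    rw [← Finset.mul_sum, hsum', mul_one]

lemma IsSpectralDecomposition.mul_apply {x : V} {c : ℝ →₀ V} (h : IsSpectralDecomposition x c)
    (t : ℝ) : x * c t = t • c t := by
  rw [h.eq_sum, Finsupp.sum, Finset.sum_mul]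
  rw [Finset.sum_eq_single t]
  · rw [smul_mul_assoc, h.idempotent]
  · intro s _ hs; rw [smul_mul_assoc, h.orthogonal s t hs, smul_zero]
  · intro ht; simp [Finsupp.notMem_support_iff.mp ht]

/-- Uniqueness of the spectral decomposition. -/
theorem IsSpectralDecomposition.unique {x : V} {c d : ℝ →₀ V} (hc : IsSpectralDecomposition x c)
    (hd : IsSpectralDecomposition x d) : c = d := by
  have h0 : ∀ s t, s ≠ t → inner ℝ (c s) (d t) = 0 := fun s t hst => by
    have h := inner_mul_left x (c s) (d t)
    rw [hc.mul_apply, hd.mul_apply, inner_smul_left, inner_smul_right] at h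
    have : (s - t) * inner ℝ (c s) (d t) = 0 := by
      simp only [conj_trivial] at h; linarith
    exact (mul_eq_zero.mp this).resolve_left (sub_ne_zero.mpr hst)
  ext t
  -- Expanding 1 in the other decomposition leaves only the index t, so ⟨c t, d t⟩ = ‖c t‖² = ‖d
  -- t‖², whence c t = d t.
  have h1 : inner ℝ (c t) (d t) = inner ℝ (c t) (c t) := by
    rw [← tr_mul (c t) (c t), hc.idempotent, tr, ← hd.complete, Finsupp.sum, inner_sum,
      Finset.sum_eq_single t (fun s _ hs => h0 t s hs.symm)]
    intro ht; simp [Finsupp.notMem_support_iff.mp ht]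
  have h2 : inner ℝ (c t) (d t) = inner ℝ (d t) (d t) := by
    rw [← tr_mul (d t) (d t), hd.idempotent, tr, ← hc.complete, Finsupp.sum, inner_sum,
      Finset.sum_eq_single t (fun s _ hs => by rw [real_inner_comm]; exact h0 s t hs),
      real_inner_comm]
    intro ht; simp [Finsupp.notMem_support_iff.mp ht]
  rw [← sub_eq_zero, ← inner_self_eq_zero (𝕜 := ℝ), inner_sub_left, inner_sub_right, inner_sub_right,
    real_inner_comm (c t) (d t)]
  linarith

lemma spectral_isSpectralDecomposition (x : V) : IsSpectralDecomposition x (spectral x) := by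
  rw [spectral, dif_pos (exists_isSpectralDecomposition x)]
  exact (exists_isSpectralDecomposition x).choose_spec

lemma IsSpectralDecomposition.spectral_eq {x : V} {c : ℝ →₀ V} (h : IsSpectralDecomposition x c) :
    spectral x = c := (spectral_isSpectralDecomposition x).unique h

lemma spectral_mul_self (x : V) (t : ℝ) : spectral x t * spectral x t = spectral x t :=
  (spectral_isSpectralDecomposition x).idempotent t

lemma mul_spectral (x : V) (t : ℝ) : x * spectral x t = t • spectral x t :=
  (spectral_isSpectralDecomposition x).mul_apply t

lemma sum_spectral (x : V) : ∑ t ∈ (spectral x).support, spectral x t = 1 :=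
  (spectral_isSpectralDecomposition x).complete

lemma funCalc_eq_sum (f : ℝ → ℝ) (x : V) :
    funCalc f x = ∑ t ∈ (spectral x).support, f t • spectral x t := rfl

lemma funCalc_id (x : V) : funCalc (fun t => t) x = x :=
  ((spectral_isSpectralDecomposition x).eq_sum).symm

lemma funCalc_const (r : ℝ) (x : V) : funCalc (fun _ => r) x = r • 1 := by
  rw [funCalc_eq_sum, ← Finset.smul_sum, sum_spectral]

lemma mul_funCalc (f : ℝ → ℝ) (x : V) : x * funCalc f x = funCalc (fun t => t * f t) x := by
  simp only [funCalc_eq_sum, Finset.mul_sum, mul_smul_comm, mul_spectral, smul_smul]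
  simp only [mul_comm]

lemma funCalc_congr {f g : ℝ → ℝ} {x : V} (h : ∀ t ∈ (spectral x).support, f t = g t) :
    funCalc f x = funCalc g x :=
  Finset.sum_congr rfl fun t ht => by simp only [h t ht]

/-- Injectivity keeps distinct eigenvalues distinct, so no idempotents merge. Shifts and nonzero
scalings are the cases needed. -/
lemma spectral_funCalc {φ : ℝ → ℝ} (hφ : Function.Injective φ) (x : V) :
    spectral (funCalc φ x) = (spectral x).embDomain ⟨φ, hφ⟩ := by
  have h := spectral_isSpectralDecomposition x
  apply IsSpectralDecomposition.spectral_eq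
  have key : ∀ t, (∃ s, φ s = t ∧ (spectral x).embDomain ⟨φ, hφ⟩ t = spectral x s) ∨
      (spectral x).embDomain ⟨φ, hφ⟩ t = 0 := fun t => by
    by_cases ht : t ∈ Set.range φ
    · obtain ⟨s, rfl⟩ := ht
      exact Or.inl ⟨s, rfl, Finsupp.embDomain_apply_self ⟨φ, hφ⟩ (spectral x) s⟩
    · exact Or.inr (Finsupp.embDomain_of_notMem_range _ _ _ ht)
  refine ⟨fun t => ?_, fun s t hst => ?_, ?_, ?_⟩
  · rcases key t with ⟨s, -, hs⟩ | h0
    · rw [hs, h.idempotent]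
    · rw [h0, mul_zero]
  · rcases key s with ⟨a, ha, hs⟩ | h0
    · rcases key t with ⟨b, hb, ht⟩ | h0
      · rw [hs, ht, h.orthogonal]
        rintro rfl
        exact hst (ha.symm.trans hb)
      · rw [h0, mul_zero]
    · rw [h0, zero_mul]
  · rw [Finsupp.sum_embDomain]; exact h.complete
  · rw [Finsupp.sum_embDomain]; rfl

lemma funCalc_funCalc (f : ℝ → ℝ) {φ : ℝ → ℝ} (hφ : Function.Injective φ) (x : V) :
    funCalc f (funCalc φ x) = funCalc (fun t => f (φ t)) x := by
  rw [funCalc, spectral_funCalc hφ, Finsupp.sum_embDomain]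
  rfl

lemma funCalc_add_smul_one (x : V) (r : ℝ) : funCalc (fun t => t + r) x = x + r • 1 := by
  rw [← funCalc_const r x]
  conv_rhs => lhs; rw [← funCalc_id x]
  simp only [funCalc_eq_sum, add_smul, Finset.sum_add_distrib]

lemma funCalc_mul_const (x : V) (r : ℝ) : funCalc (fun t => r * t) x = r • x := by
  conv_rhs => rw [← funCalc_id x]
  simp only [funCalc_eq_sum, Finset.smul_sum, smul_smul]

end Algebra

end EuclideanJordanAlgebra

namespace EuclideanJordanAlgebra

/-! ### Trace functions, Klein's inequality, order and the negative part. -/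

section TraceInequalities

variable {V : Type*} [EuclideanJordanAlgebra V]

/-- The trace function `tr f(x)`. -/
noncomputable def trFun (f : ℝ → ℝ) (x : V) : ℝ := tr (funCalc f x)

lemma trFun_eq_sum (f : ℝ → ℝ) (x : V) :
    trFun f x = ∑ t ∈ (spectral x).support, f t * tr (spectral x t) := by
  simp only [trFun, tr, funCalc_eq_sum, sum_inner, inner_smul_left, conj_trivial]

lemma tr_spectral_nonneg (x : V) (t : ℝ) : 0 ≤ tr (spectral x t) :=
  tr_idempotent_nonneg (spectral_mul_self x t)

lemma tr_spectral_pos {x : V} {t : ℝ} (ht : t ∈ (spectral x).support) : 0 < tr (spectral x t) := by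
  rw [tr_idempotent (spectral_mul_self x t)]
  have := norm_pos_iff.mpr (Finsupp.mem_support_iff.mp ht)
  positivity

lemma trFun_congr {f g : ℝ → ℝ} {x : V} (h : ∀ t ∈ (spectral x).support, f t = g t) :
    trFun f x = trFun g x := by
  rw [trFun, funCalc_congr h, trFun]

lemma trFun_const (r : ℝ) (x : V) : trFun (fun _ => r) x = r * tr (1 : V) := by
  rw [trFun, funCalc_const, tr, inner_smul_left, tr, conj_trivial]

lemma trFun_nonneg {f : ℝ → ℝ} {x : V} (h : ∀ t ∈ (spectral x).support, 0 ≤ f t) :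
    0 ≤ trFun f x := by
  rw [trFun_eq_sum]
  exact Finset.sum_nonneg fun t ht => mul_nonneg (h t ht) (tr_spectral_nonneg x t)

lemma trFun_add (f g : ℝ → ℝ) (x : V) :
    trFun (fun t => f t + g t) x = trFun f x + trFun g x := by
  simp only [trFun_eq_sum, add_mul, Finset.sum_add_distrib]

lemma trFun_sub (f g : ℝ → ℝ) (x : V) :
    trFun (fun t => f t - g t) x = trFun f x - trFun g x := by
  simp only [trFun_eq_sum, sub_mul, Finset.sum_sub_distrib]

lemma trFun_const_mul (r : ℝ) (f : ℝ → ℝ) (x : V) :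
    trFun (fun t => r * f t) x = r * trFun f x := by
  simp only [trFun_eq_sum, mul_assoc, Finset.mul_sum]

lemma trFun_id (x : V) : trFun (fun t => t) x = tr x := by rw [trFun, funCalc_id]

lemma trFun_add_smul_one (f : ℝ → ℝ) (x : V) (r : ℝ) :
    trFun f (x + r • 1) = trFun (fun t => f (t + r)) x := by
  rw [trFun, ← funCalc_add_smul_one, funCalc_funCalc f (add_left_injective r), trFun]

lemma trFun_smul (f : ℝ → ℝ) (x : V) {r : ℝ} (hr : r ≠ 0) :
    trFun f (r • x) = trFun (fun t => f (r * t)) x := by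
  rw [trFun, ← funCalc_mul_const, funCalc_funCalc f (mul_right_injective₀ hr), trFun]

lemma tendsto_trFun {ι : Type*} {l : Filter ι} {F : ι → ℝ → ℝ} {f : ℝ → ℝ}
    (h : ∀ t, Filter.Tendsto (fun i => F i t) l (nhds (f t))) (x : V) :
    Filter.Tendsto (fun i => trFun (F i) x) l (nhds (trFun f x)) := by
  simp only [trFun_eq_sum]
  exact tendsto_finsetSum _ fun t _ => (h t).mul_const _

/-- The sum of `F s t` over the eigenvalues `s` of `x` and `t` of `y`, weighted by the inner products
of the spectral idempotents. -/
noncomputable def pairSum (x y : V) (F : ℝ → ℝ → ℝ) : ℝ :=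
  ∑ s ∈ (spectral x).support, ∑ t ∈ (spectral y).support,
    F s t * inner ℝ (spectral x s) (spectral y t)

lemma inner_funCalc (f g : ℝ → ℝ) (x y : V) :
    inner ℝ (funCalc f x) (funCalc g y) = pairSum x y fun s t => f s * g t := by
  rw [funCalc_eq_sum, funCalc_eq_sum, sum_inner]
  refine Finset.sum_congr rfl fun s _ => ?_
  rw [inner_smul_left, inner_sum, Finset.mul_sum]
  refine Finset.sum_congr rfl fun t _ => ?_
  rw [inner_smul_right, conj_trivial, mul_assoc]

/-- The weights ⟨c_s, d_t⟩ are nonnegative. Scalar inequalities thereby lift to trace inequalities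
for elements with no common spectral decomposition. -/
lemma pairSum_mono {x y : V} {F G : ℝ → ℝ → ℝ}
    (h : ∀ s ∈ (spectral x).support, ∀ t ∈ (spectral y).support, F s t ≤ G s t) :
    pairSum x y F ≤ pairSum x y G :=
  Finset.sum_le_sum fun s hs => Finset.sum_le_sum fun t ht =>
    mul_le_mul_of_nonneg_right (h s hs t ht)
      (inner_idempotent_nonneg (spectral_mul_self x s) (spectral_mul_self y t))

lemma pairSum_sub (x y : V) (F G : ℝ → ℝ → ℝ) :
    pairSum x y (fun s t => F s t - G s t) = pairSum x y F - pairSum x y G := by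
  simp only [pairSum, sub_mul, Finset.sum_sub_distrib]

lemma pairSum_const_mul (x y : V) (r : ℝ) (F : ℝ → ℝ → ℝ) :
    pairSum x y (fun s t => r * F s t) = r * pairSum x y F := by
  simp only [pairSum, mul_assoc, Finset.mul_sum]

lemma pairSum_left (f : ℝ → ℝ) (x y : V) : pairSum x y (fun s _ => f s) = trFun f x := by
  have := inner_funCalc f (fun _ => 1) x y
  rw [funCalc_const, one_smul] at this
  rw [trFun, tr, this]; simp

lemma pairSum_right (g : ℝ → ℝ) (x y : V) : pairSum x y (fun _ t => g t) = trFun g y := by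
  have := inner_funCalc (fun _ => 1) g x y
  rw [funCalc_const, one_smul, real_inner_comm] at this
  rw [trFun, tr, this]; simp

lemma pairSum_sub_mul (g : ℝ → ℝ) (x y : V) :
    pairSum x y (fun s t => g t * (s - t)) = inner ℝ (funCalc g y) (x - y) := by
  have h1 := inner_funCalc (fun t => t) g x y
  have h2 := inner_mul_assoc y (funCalc g y) 1
  rw [mul_funCalc, mul_one] at h2
  have h3 := pairSum_right (fun t => t * g t) x y
  rw [trFun, tr, h2] at h3
  rw [funCalc_id] at h1
  rw [inner_sub_right, real_inner_comm, h1, real_inner_comm, ← h3, ← pairSum_sub]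
  congr 1
  ext s t
  ring

lemma pairSum_sub_sq (x y : V) : pairSum x y (fun s t => (s - t) ^ 2) = ‖x - y‖ ^ 2 := by
  have h1 := inner_funCalc (fun t => t) (fun t => t) x y
  have h2 := pairSum_left (fun t => t * t) x y
  have h3 := pairSum_right (fun t => t * t) x y
  have e : ∀ z : V, trFun (fun t => t * t) z = inner ℝ z z := fun z => by
    have := mul_funCalc (fun t => t) z
    rw [funCalc_id] at this
    rw [trFun, ← this, tr_mul]
  rw [e] at h2 h3
  rw [funCalc_id, funCalc_id] at h1
  rw [← real_inner_self_eq_norm_sq, inner_sub_left, inner_sub_right, inner_sub_right,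
    real_inner_comm x y, h1, ← h2, ← h3, ← pairSum_sub, ← pairSum_sub, ← pairSum_sub]
  congr 1
  ext s t
  ring

/-- Klein's inequality. -/
theorem klein_inequality {f g : ℝ → ℝ} {x y : V}
    (h : ∀ s ∈ (spectral x).support, ∀ t ∈ (spectral y).support, g t * (s - t) ≤ f s - f t) :
    inner ℝ (funCalc g y) (x - y) ≤ trFun f x - trFun f y := by
  rw [← pairSum_sub_mul, ← pairSum_left f x y, ← pairSum_right f x y, ← pairSum_sub]
  exact pairSum_mono h

/-- First order Taylor estimate for trace functions. -/
theorem abs_trFun_sub_le {f g : ℝ → ℝ} {K : ℝ} {x y : V}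
    (h : ∀ s ∈ (spectral x).support, ∀ t ∈ (spectral y).support,
      |f s - f t - g t * (s - t)| ≤ K * (s - t) ^ 2) :
    |trFun f x - trFun f y - inner ℝ (funCalc g y) (x - y)| ≤ K * ‖x - y‖ ^ 2 := by
  rw [← pairSum_sub_mul, ← pairSum_left f x y, ← pairSum_right f x y, ← pairSum_sub, ← pairSum_sub,
    ← pairSum_sub_sq, ← pairSum_const_mul, abs_le]
  constructor
  · rw [neg_eq_neg_one_mul, ← pairSum_const_mul]
    exact pairSum_mono fun s hs t ht => by linarith [neg_le_of_abs_le (h s hs t ht)]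
  · exact pairSum_mono fun s hs t ht => le_of_abs_le (h s hs t ht)

/-- `x ≥ δ`, tested against all idempotents. -/
def AtLeast (δ : ℝ) (x : V) : Prop := ∀ e : V, e * e = e → δ * tr e ≤ inner ℝ x e

/-- Test against the spectral idempotents of x itself. Together with `atLeast_of_le` this identifies
a spectral lower bound with a condition linear in x, hence stable under sums. -/
lemma AtLeast.le {δ : ℝ} {x : V} (h : AtLeast δ x) {t : ℝ} (ht : t ∈ (spectral x).support) :
    δ ≤ t := by
  have h1 := h _ (spectral_mul_self x t)
  have h2 : inner ℝ x (spectral x t) = t * tr (spectral x t) := by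
    rw [← tr_mul, mul_spectral, tr, inner_smul_left, tr, conj_trivial]
  rw [h2] at h1
  exact le_of_mul_le_mul_right h1 (tr_spectral_pos ht)

lemma inner_eq_pairSum_left (x e : V) :
    inner ℝ x e = ∑ t ∈ (spectral x).support, t * inner ℝ (spectral x t) e := by
  conv_lhs => rw [← funCalc_id x]
  simp only [funCalc_eq_sum, sum_inner, inner_smul_left, conj_trivial]

lemma tr_eq_sum_inner_spectral (x e : V) :
    tr e = ∑ t ∈ (spectral x).support, inner ℝ (spectral x t) e := by
  rw [← sum_inner, sum_spectral, tr, real_inner_comm]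

lemma atLeast_of_le {δ : ℝ} {x : V} (h : ∀ t ∈ (spectral x).support, δ ≤ t) : AtLeast δ x := by
  intro e he
  rw [tr_eq_sum_inner_spectral x e, Finset.mul_sum, inner_eq_pairSum_left]
  exact Finset.sum_le_sum fun t ht => mul_le_mul_of_nonneg_right (h t ht)
    (inner_idempotent_nonneg (spectral_mul_self x t) he)

lemma AtLeast.add {δ ε : ℝ} {x y : V} (hx : AtLeast δ x) (hy : AtLeast ε y) :
    AtLeast (δ + ε) (x + y) := fun e he => by
  rw [inner_add_left, add_mul]; exact add_le_add (hx e he) (hy e he)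

lemma AtLeast.mono {δ ε : ℝ} {x : V} (hx : AtLeast δ x) (h : ε ≤ δ) : AtLeast ε x := fun e he =>
  (mul_le_mul_of_nonneg_right h (tr_idempotent_nonneg he)).trans (hx e he)

lemma AtLeast.smul {δ r : ℝ} {x : V} (hx : AtLeast δ x) (hr : 0 ≤ r) :
    AtLeast (r * δ) (r • x) := fun e he => by
  rw [inner_smul_left, mul_assoc, conj_trivial]; exact mul_le_mul_of_nonneg_left (hx e he) hr

lemma atLeast_smul_one (r : ℝ) : AtLeast r (r • (1 : V)) := fun e _ => by
  rw [inner_smul_left, real_inner_comm, tr, conj_trivial]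

lemma atLeast_convex_combination {ι : Type*} (s : Finset ι) {p : ι → ℝ} (hp : ∀ i ∈ s, 0 ≤ p i)
    (hp1 : ∑ i ∈ s, p i = 1) {δ : ℝ} {A : ι → V} (hA : ∀ i, AtLeast δ (A i)) :
    AtLeast δ (∑ i ∈ s, p i • A i) := fun e he => by
  rw [sum_inner, ← one_mul (δ * tr e), ← hp1, Finset.sum_mul]
  refine Finset.sum_le_sum fun i hi => ?_
  rw [inner_smul_left, conj_trivial]
  exact mul_le_mul_of_nonneg_left (hA i e he) (hp i hi)

lemma atLeast_of_mem_positiveCone {x : V} (hx : x ∈ positiveCone V) : AtLeast 0 x := by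
  obtain ⟨y, rfl⟩ := hx
  intro e he
  rw [zero_mul, inner_mul_assoc, mul_comm y e, real_inner_comm]
  exact inner_mul_self_nonneg he y

/-- The trace of the negative part. -/
noncomputable def trNeg (x : V) : ℝ := trFun (fun t => max (-t) 0) x

lemma trNeg_nonneg (x : V) : 0 ≤ trNeg x := trFun_nonneg fun _ _ => le_max_right _ _

/-- Klein's inequality for the negative part. -/
lemma klein_trNeg (x y : V) :
    inner ℝ (funCalc (fun t => if t < 0 then -1 else 0) y) (x - y) ≤ trNeg x - trNeg y := by
  apply klein_inequality
  intro s _ t _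
  split_ifs with h
  · rw [max_eq_left (by linarith : 0 ≤ -t)]
    linarith [le_max_left (-s) 0]
  · rw [max_eq_right (by linarith : -t ≤ 0)]
    linarith [le_max_right (-s) 0]

/-- The trace of the negative part is convex. -/
theorem trNeg_sum_le {ι : Type*} (s : Finset ι) {p : ι → ℝ} (hp : ∀ i ∈ s, 0 ≤ p i)
    (hp1 : ∑ i ∈ s, p i = 1) (x : ι → V) :
    trNeg (∑ i ∈ s, p i • x i) ≤ ∑ i ∈ s, p i * trNeg (x i) := by
  set y := ∑ i ∈ s, p i • x i with hy
  set g := funCalc (fun t => if t < 0 then (-1 : ℝ) else 0) y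
  -- g is a subgradient at the average y, and the weighted deviations from y sum to zero.
  have h : ∑ i ∈ s, p i * inner ℝ g (x i - y) ≤ ∑ i ∈ s, p i * (trNeg (x i) - trNeg y) :=
    Finset.sum_le_sum fun i hi => mul_le_mul_of_nonneg_left (klein_trNeg _ _) (hp i hi)
  have h0 : ∑ i ∈ s, p i * inner ℝ g (x i - y) = 0 := by
    simp_rw [inner_sub_right, mul_sub, Finset.sum_sub_distrib, ← Finset.sum_mul, hp1, one_mul]
    rw [sub_eq_zero]
    conv_rhs => rw [hy]
    simp only [inner_sum, inner_smul_right]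
  simp_rw [h0, mul_sub, Finset.sum_sub_distrib, ← Finset.sum_mul, hp1, one_mul] at h
  linarith

lemma norm_funCalc_le {f : ℝ → ℝ} {M : ℝ} {x : V} (h : ∀ t ∈ (spectral x).support, |f t| ≤ M) :
    ‖funCalc f x‖ ^ 2 ≤ M ^ 2 * tr (1 : V) := by
  rw [← real_inner_self_eq_norm_sq, inner_funCalc, ← trFun_const (M ^ 2) x, ← pairSum_left _ x x]
  have e : ∀ s t, s ≠ t → inner ℝ (spectral x s) (spectral x t) = 0 := fun s t hst => by
    rw [← tr_mul, (spectral_isSpectralDecomposition x).orthogonal s t hst, tr, inner_zero_left]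
  refine Finset.sum_le_sum fun s hs => Finset.sum_le_sum fun t ht => ?_
  by_cases hst : s = t
  · subst hst
    refine mul_le_mul_of_nonneg_right ?_ real_inner_self_nonneg
    have := sq_le_sq' (neg_le_of_abs_le (h s hs)) (le_of_abs_le (h s hs))
    linarith
  · rw [e s t hst, mul_zero, mul_zero]

lemma abs_inner_funCalc_le {f : ℝ → ℝ} {M : ℝ} (hM : 0 ≤ M) {x : V}
    (h : ∀ t ∈ (spectral x).support, |f t| ≤ M) (y : V) :
    |inner ℝ (funCalc f x) y| ≤ M * √(tr (1 : V)) * ‖y‖ := by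
  refine (abs_real_inner_le_norm _ _).trans (mul_le_mul_of_nonneg_right ?_ (norm_nonneg y))
  rw [← Real.sqrt_sq hM, ← Real.sqrt_mul (sq_nonneg M)]
  exact Real.le_sqrt_of_sq_le (norm_funCalc_le h)

/-- The subgradients from `klein_trNeg` have eigenvalues -1 and 0, so their norm is at most ‖1‖ =
√(tr 1). -/
lemma abs_trNeg_sub_le (x y : V) : |trNeg x - trNeg y| ≤ √(tr (1 : V)) * ‖x - y‖ := by
  have key : ∀ a b : V, -(√(tr (1 : V)) * ‖a - b‖) ≤ trNeg a - trNeg b := fun a b => by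
    refine le_trans (neg_le_of_abs_le ?_) (klein_trNeg a b)
    have := abs_inner_funCalc_le zero_le_one (f := fun t => if t < 0 then (-1 : ℝ) else 0) (x := b)
      (fun t _ => by split_ifs <;> simp) (a - b)
    simpa using this
  rw [abs_le]
  refine ⟨key x y, ?_⟩
  have := key y x
  rw [norm_sub_rev] at this
  linarith

lemma continuous_trNeg : Continuous (trNeg : V → ℝ) := by
  have : LipschitzWith (Real.toNNReal √(tr (1 : V))) (trNeg : V → ℝ) :=
    LipschitzWith.of_dist_le_mul fun x y => by
      rw [Real.dist_eq, dist_eq_norm, Real.coe_toNNReal _ (Real.sqrt_nonneg _)]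
      exact abs_trNeg_sub_le x y
  exact this.continuous

end TraceInequalities

end EuclideanJordanAlgebra

/-! ### Scalar Taylor estimates for arctan, log and t log t - t. -/

section Scalar

/-- First order Taylor estimate for a function with Lipschitz derivative. -/
lemma abs_sub_sub_mul_le_of_lipschitz_deriv {f g : ℝ → ℝ} {I : Set ℝ} (hI : Convex ℝ I) {K : ℝ}
    (hf : ∀ t ∈ I, HasDerivAt f (g t) t) (hK : ∀ s ∈ I, ∀ t ∈ I, |g s - g t| ≤ K * |s - t|)
    {s t : ℝ} (hs : s ∈ I) (ht : t ∈ I) : |f s - f t - g t * (s - t)| ≤ K * (s - t) ^ 2 := by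
  have hsub : Set.uIcc t s ⊆ I := by
    rw [← segment_eq_uIcc]; exact hI.segment_subset ht hs
  have hK0 : ∀ u ∈ Set.uIcc t s, |g u - g t| ≤ K * |s - t| := fun u hu => by
    rcases eq_or_ne s t with rfl | hne
    · simp at hu; simp [hu]
    · have h1 := hK s hs t ht
      have hKn : 0 ≤ K := by
        by_contra hneg
        have : K * |s - t| < 0 := mul_neg_of_neg_of_pos (not_le.mp hneg) (abs_pos.mpr (sub_ne_zero.mpr hne))
        linarith [abs_nonneg (g s - g t)]
      refine (hK u (hsub hu) t ht).trans (mul_le_mul_of_nonneg_left ?_ hKn)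
      rw [abs_sub_comm u, abs_sub_comm s]
      have := Set.abs_sub_left_of_mem_uIcc hu
      rw [abs_sub_comm t u, abs_sub_comm t s]
      exact this
  -- Mean value inequality for f minus its tangent part; the derivative g u - g t is at most K|s -
  -- t| between t and s.
  have h := (convex_uIcc t s).norm_image_sub_le_of_norm_hasDerivWithin_le
    (f := fun u => f u - g t * u) (f' := fun u => g u - g t) (C := K * |s - t|)
    (fun u hu => ((hf u (hsub hu)).sub
      (by simpa using (hasDerivAt_id u).const_mul (g t))).hasDerivWithinAt)
    (fun u hu => by rw [Real.norm_eq_abs]; exact hK0 u hu)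
    Set.left_mem_uIcc Set.right_mem_uIcc
  rw [Real.norm_eq_abs, Real.norm_eq_abs] at h
  have e : K * |s - t| * |s - t| = K * (s - t) ^ 2 := by rw [mul_assoc, ← sq, sq_abs]
  rw [e] at h
  convert h using 2
  ring

lemma abs_inv_one_add_sq_sub_le (a b : ℝ) : |1 / (1 + a ^ 2) - 1 / (1 + b ^ 2)| ≤ |a - b| := by
  have ha : 0 < 1 + a ^ 2 := by positivity
  have hb : 0 < 1 + b ^ 2 := by positivity
  have e : 1 / (1 + a ^ 2) - 1 / (1 + b ^ 2) = (a - b) * (-(a + b) / ((1 + a ^ 2) * (1 + b ^ 2))) := by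
    field_simp; ring
  rw [e, abs_mul]
  refine mul_le_of_le_one_right (abs_nonneg _) ?_
  rw [abs_div, abs_of_pos (mul_pos ha hb), div_le_one (mul_pos ha hb), abs_le]
  constructor <;> nlinarith [sq_nonneg (a + 1), sq_nonneg (b + 1), sq_nonneg (a - 1),
    sq_nonneg (b - 1), mul_nonneg (sq_nonneg a) (sq_nonneg b)]

lemma hasDerivAt_arctan_const_mul (n t : ℝ) :
    HasDerivAt (fun t => Real.arctan (n * t)) (n * (1 / (1 + (n * t) ^ 2))) t := by
  have h1 : HasDerivAt (fun t => n * t) n t := by simpa using (hasDerivAt_id t).const_mul n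
  have := h1.arctan
  convert this using 1
  ring

lemma abs_arctan_taylor_le (n : ℕ) (s t : ℝ) :
    |Real.arctan (n * s) - Real.arctan (n * t) - n * (1 / (1 + (n * t) ^ 2)) * (s - t)| ≤
      (n * n : ℝ) * (s - t) ^ 2 := by
  refine abs_sub_sub_mul_le_of_lipschitz_deriv convex_univ (f := fun t => Real.arctan (n * t))
    (g := fun t => (n : ℝ) * (1 / (1 + ((n : ℝ) * t) ^ 2)))
    (fun t _ => hasDerivAt_arctan_const_mul n t) ?_ (Set.mem_univ s) (Set.mem_univ t)
  intro s _ t _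
  rw [← mul_sub, abs_mul, Nat.abs_cast, mul_assoc]
  refine mul_le_mul_of_nonneg_left ?_ n.cast_nonneg
  refine (abs_inv_one_add_sq_sub_le _ _).trans ?_
  rw [← mul_sub, abs_mul, Nat.abs_cast]

lemma tendsto_arctan_nat_mul (t : ℝ) :
    Tendsto (fun n : ℕ => Real.arctan (n * t)) atTop (𝓝 (Real.pi / 2 * Real.sign t)) := by
  have hn : Tendsto (fun n : ℕ => (n : ℝ)) atTop atTop := tendsto_natCast_atTop_atTop
  rcases lt_trichotomy t 0 with h | h | h
  · rw [Real.sign_of_neg h, mul_neg_one]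
    exact (tendsto_nhds_of_tendsto_nhdsWithin Real.tendsto_arctan_atBot).comp
      (hn.atTop_mul_const_of_neg h)
  · subst h; simp
  · rw [Real.sign_of_pos h, mul_one]
    exact (tendsto_nhds_of_tendsto_nhdsWithin Real.tendsto_arctan_atTop).comp
      (hn.atTop_mul_const h)

/-- The factor t f'(t) for f = arctan(n ·) governs the derivative along the flow. This bound,
uniform in n, supplies the dominating function in Sylvester's law. -/
lemma abs_mul_deriv_arctan_le (n t : ℝ) : |t * (n * (1 / (1 + (n * t) ^ 2)))| ≤ 1 := by
  have h : 0 < 1 + (n * t) ^ 2 := by positivity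
  have e : t * (n * (1 / (1 + (n * t) ^ 2))) = (n * t) / (1 + (n * t) ^ 2) := by ring
  rw [e, abs_div, abs_of_pos h, div_le_one h, abs_le]
  constructor <;> nlinarith [sq_nonneg (n * t + 1), sq_nonneg (n * t - 1)]

lemma tendsto_mul_deriv_arctan (t : ℝ) :
    Tendsto (fun n : ℕ => t * (n * (1 / (1 + ((n : ℝ) * t) ^ 2)))) atTop (𝓝 0) := by
  rcases eq_or_ne t 0 with rfl | ht
  · simp
  have h1 : Tendsto (fun n : ℕ => (1 / |t|) * (1 / (n : ℝ))) atTop (𝓝 0) := by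
    simpa using tendsto_one_div_atTop_nhds_zero_nat.const_mul (1 / |t|)
  refine squeeze_zero_norm' ?_ h1
  filter_upwards [eventually_gt_atTop 0] with n hn
  have hn' : (0 : ℝ) < n := by exact_mod_cast hn
  have ht' := abs_pos.mpr ht
  have h : 0 < 1 + ((n : ℝ) * t) ^ 2 := by positivity
  have e : t * (n * (1 / (1 + ((n : ℝ) * t) ^ 2))) = (n * t) / (1 + (n * t) ^ 2) := by ring
  rw [e, Real.norm_eq_abs, abs_div, abs_of_pos h, abs_mul, abs_of_pos hn', one_div_mul_one_div,
    div_le_div_iff₀ h (by positivity), ← sq_abs (n * t), abs_mul, abs_of_pos hn']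
  nlinarith

lemma abs_log_taylor_le {δ s t : ℝ} (hδ : 0 < δ) (hs : δ ≤ s) (ht : δ ≤ t) :
    |Real.log s - Real.log t - t⁻¹ * (s - t)| ≤ (1 / δ ^ 2) * (s - t) ^ 2 := by
  refine abs_sub_sub_mul_le_of_lipschitz_deriv (convex_Ici δ) (f := Real.log) (g := fun t => t⁻¹)
    (fun t (ht : δ ≤ t) => Real.hasDerivAt_log (by linarith)) ?_ hs ht
  intro s (hs : δ ≤ s) t (ht : δ ≤ t)
  have hs0 : 0 < s := by linarith
  have ht0 : 0 < t := by linarith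
  rw [inv_sub_inv hs0.ne' ht0.ne', abs_div, abs_of_pos (mul_pos hs0 ht0), abs_sub_comm,
    div_eq_mul_one_div, mul_comm]
  refine mul_le_mul_of_nonneg_right ?_ (abs_nonneg _)
  exact one_div_le_one_div_of_le (by positivity) (by nlinarith)

lemma abs_mul_log_sub_taylor_le {δ s t : ℝ} (hδ : 0 < δ) (hs : δ ≤ s) (ht : δ ≤ t) :
    |(s * Real.log s - s) - (t * Real.log t - t) - Real.log t * (s - t)| ≤
      (1 / δ) * (s - t) ^ 2 := by
  refine abs_sub_sub_mul_le_of_lipschitz_deriv (convex_Ici δ)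
    (f := fun t => t * Real.log t - t) (g := Real.log) (fun t (ht : δ ≤ t) => ?_) ?_ hs ht
  · have := (Real.hasDerivAt_mul_log (x := t) (by linarith)).fun_sub (hasDerivAt_id' t)
    simpa using this
  · intro s (hs : δ ≤ s) t (ht : δ ≤ t)
    have key : ∀ a b : ℝ, δ ≤ a → a ≤ b → |Real.log b - Real.log a| ≤ 1 / δ * |b - a| :=
      fun a b ha hab => by
        have ha0 : 0 < a := by linarith
        have hb0 : 0 < b := by linarith
        rw [abs_of_nonneg (sub_nonneg.mpr (Real.log_le_log ha0 hab)),
          abs_of_nonneg (sub_nonneg.mpr hab), ← Real.log_div hb0.ne' ha0.ne']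
        refine (Real.log_le_sub_one_of_pos (div_pos hb0 ha0)).trans ?_
        rw [div_sub_one ha0.ne', div_eq_mul_one_div, mul_comm]
        exact mul_le_mul_of_nonneg_right (one_div_le_one_div_of_le hδ ha) (by linarith)
    rcases le_total s t with h | h
    · rw [abs_sub_comm, abs_sub_comm s t]; exact key s t hs h
    · exact key t s ht h

end Scalar

namespace EuclideanJordanAlgebra

/-! ### Congruences exp(2 s L_a): Sylvester's law of inertia and the change of tr log. -/

section Flow

variable {V : Type*} [EuclideanJordanAlgebra V]

/-- The quadratic remainder replaces any perturbation theory of eigenvalues: only the trace function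
is differentiated, never the spectral data. -/
lemma hasDerivAt_trFun {f g : ℝ → ℝ} {K : ℝ} {y : ℝ → V} {y' : V} {s : ℝ} (hy : HasDerivAt y y' s)
    (h : ∀ᶠ u in 𝓝 s, |trFun f (y u) - trFun f (y s) - inner ℝ (funCalc g (y s)) (y u - y s)| ≤
      K * ‖y u - y s‖ ^ 2) :
    HasDerivAt (fun u => trFun f (y u)) (inner ℝ (funCalc g (y s)) y') s := by
  have hO : (fun u => y u - y s) =O[𝓝 s] fun u => u - s := hy.isBigO_sub
  have h1 : (fun u => trFun f (y u) - trFun f (y s) - inner ℝ (funCalc g (y s)) (y u - y s))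
      =O[𝓝 s] fun u => ‖y u - y s‖ ^ 2 :=
    Asymptotics.IsBigO.of_bound K (h.mono fun u hu => by
      rwa [Real.norm_eq_abs, Real.norm_eq_abs, abs_of_nonneg (sq_nonneg ‖y u - y s‖)])
  have h2 : (fun u => (u - s) ^ 2) =o[𝓝 s] fun u => u - s := by
    have : (fun u : ℝ => u - s) =o[𝓝 s] fun _ => (1 : ℝ) := by
      rw [Asymptotics.isLittleO_one_iff]
      have : Tendsto (fun u : ℝ => u - s) (𝓝 s) (𝓝 (s - s)) :=
        (continuous_id.sub continuous_const).tendsto s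
      rwa [sub_self] at this
    simpa [sq] using this.mul_isBigO (Asymptotics.isBigO_refl (fun u : ℝ => u - s) (𝓝 s))
  have h3 := (h1.trans (hO.norm_left.pow 2)).trans_isLittleO h2
  have h4 := ((innerSL ℝ (funCalc g (y s))).hasFDerivAt.comp_hasDerivAt s hy)
  rw [hasDerivAt_iff_isLittleO] at h4 ⊢
  refine (h3.add h4).congr_left fun u => ?_
  simp only [Function.comp, innerSL_apply_apply, inner_sub_right, smul_eq_mul]
  ring

/-- The one-parameter group `exp (2 s L_a)`, that is, the quadratic representation of `exp (s a)`. -/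
noncomputable def flow (a : V) (s : ℝ) : V →L[ℝ] V :=
  NormedSpace.exp (s • LinearMap.toContinuousLinearMap (LinearMap.mulLeft ℝ ((2 : ℝ) • a)))

lemma flow_zero (a y : V) : flow a 0 y = y := by
  simp [flow, NormedSpace.exp_zero]

lemma hasDerivAt_flow (a y : V) (s : ℝ) :
    HasDerivAt (fun s => flow a s y) ((2 : ℝ) • (a * flow a s y)) s := by
  have : CompleteSpace V := FiniteDimensional.complete ℝ V
  have h := hasDerivAt_exp_smul_const' (𝕂 := ℝ)
    (LinearMap.toContinuousLinearMap (LinearMap.mulLeft ℝ ((2 : ℝ) • a))) s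
  have h2 := h.clm_apply (hasDerivAt_const s y)
  simpa [flow, smul_mul_assoc] using h2

lemma flow_eigenvector {a q : V} {μ : ℝ} (h : a * q = μ • q) (s : ℝ) :
    flow a s q = Real.exp (2 * s * μ) • q := by
  have : CompleteSpace V := FiniteDimensional.complete ℝ V
  have hder : ∀ u, HasDerivAt (fun u => Real.exp (-(2 * u * μ)) • flow a u q) 0 u := fun u => by
    -- In this form the generator stands on the right of the exponential and acts directly on the
    -- eigenvector q.
    have h1 := hasDerivAt_exp_smul_const (𝕂 := ℝ)
      (LinearMap.toContinuousLinearMap (LinearMap.mulLeft ℝ ((2 : ℝ) • a))) u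
    have h2 := h1.clm_apply (hasDerivAt_const u q)
    have h3 : HasDerivAt (fun u => flow a u q) ((2 * μ) • flow a u q) u := by
      simpa [flow, smul_mul_assoc, h, smul_smul] using h2
    have h4 : HasDerivAt (fun u : ℝ => Real.exp (-(2 * u * μ)))
        (Real.exp (-(2 * u * μ)) * -(2 * μ)) u := by
      have : HasDerivAt (fun u : ℝ => -(2 * u * μ)) (-(2 * μ)) u := by
        simpa using (((hasDerivAt_id' u).const_mul 2).mul_const μ).fun_neg
      exact this.exp
    have h5 := h4.fun_smul h3
    have h6 : Real.exp (-(2 * u * μ)) • (2 * μ) • flow a u q +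
        (Real.exp (-(2 * u * μ)) * -(2 * μ)) • flow a u q = 0 := by module
    rwa [h6] at h5
  have := is_const_of_deriv_eq_zero (fun u => (hder u).differentiableAt)
    (fun u => (hder u).deriv) s 0
  simp only [flow_zero, mul_zero, zero_mul, neg_zero, Real.exp_zero, one_smul] at this
  conv_rhs => rw [← this]
  rw [smul_smul, ← Real.exp_add, add_neg_cancel, Real.exp_zero, one_smul]

lemma hasDerivAt_trFun_flow {f g : ℝ → ℝ} {K : ℝ} {a y : V} {s : ℝ}
    (h : ∀ᶠ u in 𝓝 s, ∀ r ∈ (spectral (flow a u y)).support,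
      ∀ t ∈ (spectral (flow a s y)).support, |f r - f t - g t * (r - t)| ≤ K * (r - t) ^ 2) :
    HasDerivAt (fun u => trFun f (flow a u y))
      (2 * inner ℝ (funCalc (fun t => t * g t) (flow a s y)) a) s := by
  have := hasDerivAt_trFun (f := f) (g := g) (K := K) (hasDerivAt_flow a y s)
    (h.mono fun u hu => abs_trFun_sub_le hu)
  convert this using 1
  -- Associativity of the inner product gives ⟨g(y), a y⟩ = ⟨y g(y), a⟩.
  rw [inner_smul_right, mul_comm a, ← inner_mul_assoc, mul_comm (funCalc _ _), mul_funCalc]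

/-- Sylvester's law of inertia. -/
theorem trFun_sign_flow (a y : V) (s : ℝ) :
    trFun Real.sign (flow a s y) = trFun Real.sign y := by
  -- D n is the derivative of tr arctan(n ·) along the flow. Its integral tends to 0 by dominated
  -- convergence, while the endpoint values tend to (π/2) tr sign.
  set D : ℕ → ℝ → ℝ := fun n u =>
    2 * inner ℝ (funCalc (fun t => t * (n * (1 / (1 + ((n : ℝ) * t) ^ 2)))) (flow a u y)) a with hD
  have hder : ∀ (n : ℕ) (u : ℝ), HasDerivAt (fun u => trFun (fun t => Real.arctan (n * t)) (flow a u y))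
      (D n u) u := fun n u =>
    hasDerivAt_trFun_flow (Eventually.of_forall fun _ r _ t _ => abs_arctan_taylor_le n r t)
  have hbound : ∀ (n : ℕ) (u : ℝ), ‖D n u‖ ≤ 2 * (1 * √(tr (1 : V)) * ‖a‖) := fun n u => by
    rw [hD, Real.norm_eq_abs, abs_mul, abs_two]
    exact mul_le_mul_of_nonneg_left (abs_inner_funCalc_le zero_le_one
      (fun t _ => abs_mul_deriv_arctan_le n t) a) zero_le_two
  have hmeas : ∀ n, MeasureTheory.AEStronglyMeasurable (D n) MeasureTheory.volume := fun n => by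
    have : D n = deriv (fun u => trFun (fun t => Real.arctan (n * t)) (flow a u y)) :=
      funext fun u => (hder n u).deriv.symm
    rw [this]
    exact (measurable_deriv _).aestronglyMeasurable
  have hint : ∀ n, ∫ u in (0 : ℝ)..s, D n u =
      trFun (fun t => Real.arctan (n * t)) (flow a s y) - trFun (fun t => Real.arctan (n * t)) y :=
    fun n => by
      rw [intervalIntegral.integral_eq_sub_of_hasDerivAt (fun u _ => hder n u), flow_zero]
      rw [intervalIntegrable_iff]
      refine MeasureTheory.Measure.integrableOn_of_bounded (M := 2 * (1 * √(tr (1 : V)) * ‖a‖))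
        (by simp) (hmeas n) (Eventually.of_forall fun u => hbound n u)
  have hlim : Tendsto (fun n => ∫ u in (0 : ℝ)..s, D n u) atTop (𝓝 (∫ u in (0 : ℝ)..s, (0 : ℝ))) := by
    refine intervalIntegral.tendsto_integral_filter_of_dominated_convergence
      (fun _ => 2 * (1 * √(tr (1 : V)) * ‖a‖)) (Eventually.of_forall fun n => (hmeas n).restrict)
      (Eventually.of_forall fun n => Eventually.of_forall fun u _ => hbound n u)
      intervalIntegrable_const (Eventually.of_forall fun u _ => ?_)
    have h0 : Tendsto (fun n : ℕ => 2 *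
        ∑ t ∈ (spectral (flow a u y)).support, (t * (n * (1 / (1 + ((n : ℝ) * t) ^ 2)))) *
          inner ℝ (spectral (flow a u y) t) a) atTop (𝓝 (2 *
        ∑ t ∈ (spectral (flow a u y)).support, 0 * inner ℝ (spectral (flow a u y) t) a)) :=
      (tendsto_finsetSum _ fun t _ => (tendsto_mul_deriv_arctan t).mul_const _).const_mul _
    simp only [zero_mul, Finset.sum_const_zero, mul_zero] at h0
    refine h0.congr fun n => ?_
    simp only [hD, funCalc_eq_sum, sum_inner, inner_smul_left, conj_trivial]
  have hlim2 : Tendsto (fun n => ∫ u in (0 : ℝ)..s, D n u) atTop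
      (𝓝 (trFun (fun t => Real.pi / 2 * Real.sign t) (flow a s y) -
        trFun (fun t => Real.pi / 2 * Real.sign t) y)) := by
    simp_rw [hint]
    exact (tendsto_trFun (fun t => tendsto_arctan_nat_mul t) _).sub
      (tendsto_trFun (fun t => tendsto_arctan_nat_mul t) _)
  have := tendsto_nhds_unique hlim hlim2
  rw [intervalIntegral.integral_zero, trFun_const_mul, trFun_const_mul, ← mul_sub] at this
  have h2 := (mul_eq_zero.mp this.symm).resolve_left (by positivity)
  linarith

/-- tr (1 - sign x) is a sum of nonnegative terms with positive weights. Thus positivity of the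
spectrum becomes an invariant of the flow. -/
lemma trFun_sign_eq_iff {x : V} : trFun Real.sign x = tr (1 : V) ↔
    ∀ t ∈ (spectral x).support, 0 < t := by
  have e : trFun (fun t => 1 - Real.sign t) x = tr (1 : V) - trFun Real.sign x := by
    rw [trFun_sub, trFun_const, one_mul]
  have hle : ∀ t : ℝ, 0 ≤ 1 - Real.sign t := fun t => by
    rcases Real.sign_apply_eq t with h | h | h <;> rw [h] <;> norm_num
  rw [eq_comm, ← sub_eq_zero, ← e, trFun_eq_sum, Finset.sum_eq_zero_iff_of_nonneg
    (fun t _ => mul_nonneg (hle t) (tr_spectral_nonneg x t))]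
  refine forall₂_congr fun t ht => ?_
  rw [mul_eq_zero, or_iff_left (tr_spectral_pos ht).ne']
  constructor
  · intro h
    by_contra hn
    rcases (not_lt.mp hn).lt_or_eq with h1 | h1
    · rw [Real.sign_of_neg h1] at h; norm_num at h
    · rw [h1, Real.sign_zero] at h; norm_num at h
  · intro h
    rw [Real.sign_of_pos h, sub_self]

lemma atLeast_zero_flow (a : V) {y : V} {δ : ℝ} (hδ : 0 < δ) (hy : AtLeast δ y) (s : ℝ) :
    AtLeast 0 (flow a s y) := by
  refine atLeast_of_le fun t ht => le_of_lt ?_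
  refine trFun_sign_eq_iff.mp ?_ t ht
  rw [trFun_sign_flow, trFun_sign_eq_iff]
  exact fun t ht => hδ.trans_le (hy.le ht)

lemma exists_atLeast_flow_one (a : V) (S : ℝ) :
    ∃ m, 0 < m ∧ ∀ s, |s| ≤ S → AtLeast m (flow a s 1) := by
  refine ⟨Real.exp (-(2 * S * ∑ μ ∈ (spectral a).support, |μ|)), Real.exp_pos _, fun s hs => ?_⟩
  intro e he
  rw [← sum_spectral a, map_sum, sum_inner, tr_eq_sum_inner_spectral a e, Finset.mul_sum]
  refine Finset.sum_le_sum fun μ hμ => ?_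
  rw [flow_eigenvector (mul_spectral a μ), inner_smul_left, conj_trivial]
  refine mul_le_mul_of_nonneg_right (Real.exp_le_exp.mpr ?_)
    (inner_idempotent_nonneg (spectral_mul_self a μ) he)
  have h1 : |μ| ≤ ∑ μ ∈ (spectral a).support, |μ| :=
    Finset.single_le_sum (f := fun μ => |μ|) (fun _ _ => abs_nonneg _) hμ
  have h2 : |s * μ| ≤ S * ∑ μ ∈ (spectral a).support, |μ| := by
    rw [abs_mul]
    exact mul_le_mul hs h1 (abs_nonneg _) ((abs_nonneg s).trans hs)
  have := neg_le_of_abs_le h2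
  linarith

lemma exists_atLeast_flow (a : V) {y : V} {δ : ℝ} (hδ : 0 < δ) (hy : AtLeast δ y) (S : ℝ) :
    ∃ m, 0 < m ∧ ∀ s, |s| ≤ S → AtLeast m (flow a s y) := by
  obtain ⟨m, hm, h⟩ := exists_atLeast_flow_one a S
  refine ⟨δ / 2 * m, by positivity, fun s hs => ?_⟩
  -- Split y = (y - (δ/2)1) + (δ/2)1. The first summand is still strictly positive and flows into
  -- the cone; the second is controlled by `exists_atLeast_flow_one`, uniformly in s.
  have h1 : AtLeast (δ / 2) (y - (δ / 2) • 1) := by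
    have := hy.add (atLeast_smul_one (V := V) (-(δ / 2)))
    rw [neg_smul, ← sub_eq_add_neg] at this
    rwa [sub_half, ← sub_eq_add_neg] at this
  have h2 := (atLeast_zero_flow a (half_pos hδ) h1 s).add ((h s hs).smul (half_pos hδ).le)
  rw [zero_add, map_sub, map_smul, sub_add_cancel] at h2
  exact h2

theorem trFun_log_flow (a : V) {y : V} {δ : ℝ} (hδ : 0 < δ) (hy : AtLeast δ y) (s : ℝ) :
    trFun Real.log (flow a s y) = trFun Real.log y + 2 * s * tr a := by
  have hder : ∀ u, HasDerivAt (fun u => trFun Real.log (flow a u y) - u * (2 * tr a)) 0 u :=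
    fun u => by
      obtain ⟨m, hm, h⟩ := exists_atLeast_flow a hδ hy (|u| + 1)
      have hu : ∀ᶠ v in 𝓝 u, |v| ≤ |u| + 1 :=
        (continuous_abs.tendsto u).eventually (eventually_le_nhds (by linarith))
      have h1 := hasDerivAt_trFun_flow (f := Real.log) (g := fun t => t⁻¹) (a := a) (y := y)
        (s := u) (K := 1 / m ^ 2) (hu.mono fun v hv r hr t ht =>
          abs_log_taylor_le hm ((h v hv).le hr) ((h u (by linarith)).le ht))
      -- For f = log the factor t f'(t) is 1, so the derivative is the constant 2 tr a.
      have h2 : funCalc (fun t => t * t⁻¹) (flow a u y) = 1 := by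
        rw [funCalc_congr (g := fun _ => 1) (fun t ht => mul_inv_cancel₀
          (hm.trans_le ((h u (by linarith)).le ht)).ne'), funCalc_const, one_smul]
      rw [h2, real_inner_comm] at h1
      have := h1.fun_sub ((hasDerivAt_id' u).mul_const (2 * tr a))
      simpa [tr] using this
  have := is_const_of_deriv_eq_zero (fun u => (hder u).differentiableAt)
    (fun u => (hder u).deriv) s 0
  simp only [flow_zero, zero_mul, sub_zero] at this
  linarith

end Flow

end EuclideanJordanAlgebra

/-! ### Scalar integral representations by step functions. -/

section ScalarKernel

lemma setLIntegral_Ioi_of_hasDerivAt_neg {g k : ℝ → ℝ} {a : ℝ}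
    (hderiv : ∀ x ∈ Set.Ici a, HasDerivAt g (-k x) x) (hk : ∀ x ∈ Set.Ioi a, 0 ≤ k x)
    (hg : Tendsto g atTop (𝓝 0)) :
    0 ≤ g a ∧ ∫⁻ x in Set.Ioi a, ENNReal.ofReal (k x) = ENNReal.ofReal (g a) := by
  have hneg : ∀ x ∈ Set.Ioi a, -k x ≤ 0 := fun x hx => neg_nonpos.mpr (hk x hx)
  have h1 := integral_Ioi_of_hasDerivAt_of_nonpos' hderiv hneg hg
  have h2 : IntegrableOn k (Set.Ioi a) := by
    simpa using (integrableOn_Ioi_deriv_of_nonpos' hderiv hneg hg).neg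
  rw [integral_neg, zero_sub, neg_inj] at h1
  have hk' : 0 ≤ᵐ[volume.restrict (Set.Ioi a)] k :=
    (ae_restrict_iff' measurableSet_Ioi).mpr (Eventually.of_forall hk)
  refine ⟨?_, ?_⟩
  · rw [← h1]; exact setIntegral_nonneg measurableSet_Ioi hk
  · rw [← h1, ofReal_integral_eq_lintegral_ofReal h2 hk']

/-- The indicator function of the negative half-line, with value `1/2` at `0`. -/
noncomputable def negStep (t : ℝ) : ℝ := (1 - Real.sign t) / 2

lemma negStep_of_neg {t : ℝ} (h : t < 0) : negStep t = 1 := by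
  rw [negStep, Real.sign_of_neg h]; norm_num

lemma negStep_of_pos {t : ℝ} (h : 0 < t) : negStep t = 0 := by
  rw [negStep, Real.sign_of_pos h]; norm_num

lemma negStep_nonneg (t : ℝ) : 0 ≤ negStep t := by
  rw [negStep]
  rcases Real.sign_apply_eq t with h | h | h <;> rw [h] <;> norm_num

lemma measurable_negStep : Measurable negStep := by
  unfold negStep Real.sign
  exact ((measurable_const.sub (Measurable.ite measurableSet_Iio measurable_const
    (Measurable.ite measurableSet_Ioi measurable_const measurable_const))).div_const 2)

/-- The mixed difference `log (t + Z) + log (t + h) - log t - log (t + Z + h)`. -/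
noncomputable def logKernel (Z h t : ℝ) : ℝ :=
  Real.log (t + Z) + Real.log (t + h) - Real.log t - Real.log (t + (Z + h))

/-- Minus the derivative of `logKernel`. -/
noncomputable def logKernelDensity (Z h t : ℝ) : ℝ :=
  t⁻¹ + (t + (Z + h))⁻¹ - (t + Z)⁻¹ - (t + h)⁻¹

variable {Z h : ℝ}

lemma hasDerivAt_logKernel (hZ : 0 < Z) (hh : 0 < h) {t : ℝ} (ht : 0 < t) :
    HasDerivAt (logKernel Z h) (-logKernelDensity Z h t) t := by
  have e : ∀ r, 0 < t + r → HasDerivAt (fun t => Real.log (t + r)) (t + r)⁻¹ t := fun r hr => by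
    simpa using ((hasDerivAt_id' t).add_const r).log hr.ne'
  have h1 := (((e Z (by positivity)).fun_add (e h (by positivity))).fun_sub
    (Real.hasDerivAt_log ht.ne')).fun_sub (e (Z + h) (by positivity))
  have e1 : -logKernelDensity Z h t = (t + Z)⁻¹ + (t + h)⁻¹ - t⁻¹ - (t + (Z + h))⁻¹ := by
    rw [logKernelDensity]; ring
  rw [e1]
  exact h1

lemma logKernelDensity_nonneg (hZ : 0 < Z) (hh : 0 < h) {t : ℝ} (ht : 0 < t) :
    0 ≤ logKernelDensity Z h t := by
  have e : logKernelDensity Z h t =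
      Z * h * (2 * t + Z + h) / (t * (t + (Z + h)) * ((t + Z) * (t + h))) := by
    rw [logKernelDensity]; field_simp; ring
  rw [e]; positivity

lemma logKernel_nonneg (hZ : 0 < Z) (hh : 0 < h) {t : ℝ} (ht : 0 < t) : 0 ≤ logKernel Z h t := by
  rw [logKernel, ← Real.log_mul (by positivity) (by positivity), sub_sub,
    ← Real.log_mul (by positivity) (by positivity)]
  refine sub_nonneg.mpr (Real.log_le_log (by positivity) ?_)
  nlinarith [mul_pos hZ hh]

lemma tendsto_logKernel (hZ : 0 < Z) (hh : 0 < h) : Tendsto (logKernel Z h) atTop (𝓝 0) := by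
  have h1 : Tendsto (fun t : ℝ => Z / t * (h / t)) atTop (𝓝 0) := by
    simpa using (tendsto_const_nhds (x := Z)).div_atTop tendsto_id |>.mul
      ((tendsto_const_nhds (x := h)).div_atTop tendsto_id)
  refine squeeze_zero' ?_ ?_ h1
  · filter_upwards [eventually_gt_atTop 0] with t ht using logKernel_nonneg hZ hh ht
  · filter_upwards [eventually_gt_atTop 0] with t ht
    rw [logKernel, ← Real.log_mul (by positivity) (by positivity), sub_sub,
      ← Real.log_mul (by positivity) (by positivity), ← Real.log_div (by positivity) (by positivity)]
    refine (Real.log_le_sub_one_of_pos (by positivity)).trans ?_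
    rw [div_sub_one (by positivity), div_mul_div_comm, div_le_div_iff₀ (by positivity) (by positivity)]
    have : 0 < Z * h * (t * (Z + h)) := by positivity
    nlinarith

lemma measurable_logKernelDensity (Z h : ℝ) : Measurable (logKernelDensity Z h) := by
  unfold logKernelDensity; fun_prop

lemma lintegral_logKernelDensity_mul_negStep (hZ : 0 < Z) (hh : 0 < h) {t : ℝ} (ht : 0 < t) :
    ∫⁻ c in Set.Ioi 0, ENNReal.ofReal (logKernelDensity Z h c * negStep (t - c)) =
      ENNReal.ofReal (logKernel Z h t) := by
  have h1 := (setLIntegral_Ioi_of_hasDerivAt_neg (a := t) (g := logKernel Z h)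
    (k := logKernelDensity Z h)
    (fun x hx => hasDerivAt_logKernel hZ hh (ht.trans_le hx))
    (fun x hx => logKernelDensity_nonneg hZ hh (ht.trans hx)) (tendsto_logKernel hZ hh)).2
  rw [← h1]
  have h2 : ∫⁻ c in Set.Ioi 0, ENNReal.ofReal (logKernelDensity Z h c * negStep (t - c)) =
      ∫⁻ c in Set.Ioi 0, (Set.Ioi t).indicator
        (fun c => ENNReal.ofReal (logKernelDensity Z h c)) c := by
    -- The value 1/2 of `negStep` at 0 matters only at c = t, a null set.
    refine lintegral_congr_ae (ae_restrict_of_ae ?_)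
    filter_upwards [Measure.ae_ne volume t] with c hc
    rcases lt_or_gt_of_ne hc with h | h
    · rw [negStep_of_pos (sub_pos.mpr h), mul_zero, ENNReal.ofReal_zero,
        Set.indicator_of_notMem (by simpa using h.le)]
    · rw [negStep_of_neg (sub_neg.mpr h), mul_one, Set.indicator_of_mem (by exact h)]
  rw [h2, lintegral_indicator measurableSet_Ioi, Measure.restrict_restrict measurableSet_Ioi,
    Set.inter_eq_left.mpr (Set.Ioi_subset_Ioi ht.le)]

lemma lintegral_negStep_add (t : ℝ) :
    ∫⁻ r in Set.Ioi 0, ENNReal.ofReal (negStep (t + r)) = ENNReal.ofReal (max (-t) 0) := by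
  have h2 : ∫⁻ r in Set.Ioi 0, ENNReal.ofReal (negStep (t + r)) =
      ∫⁻ r in Set.Ioi 0, (Set.Iio (-t)).indicator (fun _ => 1) r := by
    refine lintegral_congr_ae (ae_restrict_of_ae ?_)
    filter_upwards [Measure.ae_ne volume (-t)] with c hc
    rcases lt_or_gt_of_ne hc with h | h
    · rw [negStep_of_neg (by linarith), ENNReal.ofReal_one, Set.indicator_of_mem (by exact h)]
    · rw [negStep_of_pos (by linarith), ENNReal.ofReal_zero,
        Set.indicator_of_notMem (by simpa using h.le)]
  rw [h2, lintegral_indicator measurableSet_Iio, Measure.restrict_restrict measurableSet_Iio,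
    setLIntegral_const, one_mul, Set.inter_comm, Set.Ioi_inter_Iio, Real.volume_Ioo, sub_zero]
  rcases le_total (-t) 0 with h | h
  · rw [max_eq_right h, ENNReal.ofReal_of_nonpos h, ENNReal.ofReal_zero]
  · rw [max_eq_left h]

end ScalarKernel

namespace EuclideanJordanAlgebra

/-! ### The integral formula and joint convexity of the mixed difference. -/

section IntegralFormula

variable {V : Type*} [EuclideanJordanAlgebra V]

lemma continuous_trFun {f g : ℝ → ℝ} {K : ℝ}
    (h : ∀ s t, |f s - f t - g t * (s - t)| ≤ K * (s - t) ^ 2) :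
    Continuous (fun x : V => trFun f x) := by
  rw [continuous_iff_continuousAt]
  intro y
  have h1 : Tendsto (fun x => inner ℝ (funCalc g y) (x - y) + K * ‖x - y‖ ^ 2) (𝓝 y) (𝓝 0) := by
    have : Continuous fun x : V => inner ℝ (funCalc g y) (x - y) + K * ‖x - y‖ ^ 2 := by fun_prop
    simpa using this.tendsto y
  have h2 : Tendsto (fun x => inner ℝ (funCalc g y) (x - y) - K * ‖x - y‖ ^ 2) (𝓝 y) (𝓝 0) := by
    have : Continuous fun x : V => inner ℝ (funCalc g y) (x - y) - K * ‖x - y‖ ^ 2 := by fun_prop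
    simpa using this.tendsto y
  have h3 : Tendsto (fun x => trFun f x - trFun f y) (𝓝 y) (𝓝 0) := by
    refine tendsto_of_tendsto_of_tendsto_of_le_of_le h2 h1 (fun x => ?_) (fun x => ?_)
    · have := neg_le_of_abs_le (abs_trFun_sub_le (x := x) (y := y) fun s _ t _ => h s t)
      simp only; linarith
    · have := le_of_abs_le (abs_trFun_sub_le (x := x) (y := y) fun s _ t _ => h s t)
      simp only; linarith
  simpa [ContinuousAt] using h3.add_const (trFun f y)

/-- Obtained as an affine function of tr sign, a pointwise limit of the continuous functions tr
arctan(n ·); measurability is needed for Tonelli. -/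
lemma measurable_trFun_negStep {α : Type*} [TopologicalSpace α] [MeasurableSpace α] [BorelSpace α]
    {F : α → V} (hF : Continuous F) : Measurable fun a => trFun negStep (F a) := by
  have h1 : Measurable fun a => trFun (fun t => Real.pi / 2 * Real.sign t) (F a) :=
    measurable_of_tendsto_metrizable
      (fun n : ℕ => ((continuous_trFun (V := V) (abs_arctan_taylor_le n)).comp hF).measurable)
      (tendsto_pi_nhds.mpr fun a => tendsto_trFun (fun t => tendsto_arctan_nat_mul t) (F a))
  have h2 : (fun a => trFun negStep (F a)) = fun a =>
      2⁻¹ * (tr (1 : V) - (Real.pi / 2)⁻¹ *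
        trFun (fun t => Real.pi / 2 * Real.sign t) (F a)) := by
    ext a
    have e1 : negStep = fun t => 2⁻¹ * (1 - Real.sign t) := by
      ext t; rw [negStep]; ring
    rw [trFun_const_mul, inv_mul_cancel_left₀ (by positivity), e1, trFun_const_mul, trFun_sub,
      trFun_const, one_mul]
  rw [h2]
  exact (measurable_const.sub (h1.const_mul _)).const_mul _

lemma ofReal_trFun {f : ℝ → ℝ} {x : V} (h : ∀ t ∈ (spectral x).support, 0 ≤ f t) :
    ENNReal.ofReal (trFun f x) =
      ∑ t ∈ (spectral x).support, ENNReal.ofReal (f t) * ENNReal.ofReal (tr (spectral x t)) := by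
  rw [trFun_eq_sum, ENNReal.ofReal_sum_of_nonneg
    (fun t ht => mul_nonneg (h t ht) (tr_spectral_nonneg x t))]
  exact Finset.sum_congr rfl fun t ht => ENNReal.ofReal_mul (h t ht)

lemma lintegral_ofReal_trFun {F : ℝ → ℝ → ℝ} {f : ℝ → ℝ} {x : V}
    (hF : ∀ t ∈ (spectral x).support, ∀ a ∈ Set.Ioi (0 : ℝ), 0 ≤ F a t)
    (hm : ∀ t, Measurable fun a => F a t)
    (hf : ∀ t ∈ (spectral x).support, 0 ≤ f t)
    (h : ∀ t ∈ (spectral x).support,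
      ∫⁻ a in Set.Ioi 0, ENNReal.ofReal (F a t) = ENNReal.ofReal (f t)) :
    ∫⁻ a in Set.Ioi 0, ENNReal.ofReal (trFun (F a) x) = ENNReal.ofReal (trFun f x) := by
  rw [ofReal_trFun hf, setLIntegral_congr_fun measurableSet_Ioi
    (fun a ha => ofReal_trFun fun t ht => hF t ht a ha),
    lintegral_finsetSum _ fun t _ => (hm t).ennreal_ofReal.mul_const _]
  refine Finset.sum_congr rfl fun t ht => ?_
  rw [lintegral_mul_const _ (hm t).ennreal_ofReal, h t ht]

lemma lintegral_trFun_negStep_add (y : V) :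
    ∫⁻ r in Set.Ioi (0 : ℝ), ENNReal.ofReal (trFun negStep (y + r • 1)) = ENNReal.ofReal (trNeg y) := by
  simp_rw [trFun_add_smul_one]
  exact lintegral_ofReal_trFun (fun t _ a _ => negStep_nonneg _)
    (fun t => measurable_negStep.comp (measurable_const.add measurable_id))
    (fun t _ => le_max_right _ _) (fun t _ => lintegral_negStep_add t)

lemma lintegral_logKernelDensity_mul_trFun {Z h : ℝ} (hZ : 0 < Z) (hh : 0 < h) {x : V}
    (hx : ∀ t ∈ (spectral x).support, 0 < t) :
    ∫⁻ c in Set.Ioi 0, ENNReal.ofReal (logKernelDensity Z h c * trFun negStep (x - c • 1)) =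
      ENNReal.ofReal (trFun (logKernel Z h) x) := by
  simp_rw [sub_eq_add_neg x, ← neg_smul, trFun_add_smul_one, ← trFun_const_mul, ← sub_eq_add_neg]
  exact lintegral_ofReal_trFun
    (fun t _ a ha => mul_nonneg (logKernelDensity_nonneg hZ hh ha) (negStep_nonneg _))
    (fun t => (measurable_logKernelDensity Z h).mul
      (measurable_negStep.comp (measurable_const.sub measurable_id)))
    (fun t ht => logKernel_nonneg hZ hh (hx t ht))
    (fun t ht => lintegral_logKernelDensity_mul_negStep hZ hh (hx t ht))

/-- Simultaneous reduction of `B` to the unit, which shifts `tr log` by a constant and preserves the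
inertia. -/
lemma exists_congruence {B : V} {β : ℝ} (hβ : 0 < β) (hB : AtLeast β B) :
    ∃ (P : V →L[ℝ] V) (κ : ℝ), P B = 1 ∧
      (∀ y, trFun negStep (P y) = trFun negStep y) ∧
      ∀ y δ, 0 < δ → AtLeast δ y → (∀ t ∈ (spectral (P y)).support, 0 < t) ∧
        trFun Real.log (P y) = trFun Real.log y + κ := by
  -- With a = -(1/2) log B, the flow at time 1 multiplies each spectral idempotent of B by exp(-log
  -- t) = 1/t, so B goes to 1.
  set a := funCalc (fun t => -(1 / 2) * Real.log t) B with ha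
  refine ⟨flow a 1, 2 * 1 * tr a, ?_, fun y => ?_, fun y δ hδ hy => ⟨fun t ht => ?_,
    trFun_log_flow a hδ hy 1⟩⟩
  · have h1 : ∀ t ∈ (spectral B).support, flow a 1 (t • spectral B t) = spectral B t := fun t ht => by
      have hs := spectral_isSpectralDecomposition B
      have h2 : a * spectral B t = (-(1 / 2) * Real.log t) • spectral B t := by
        rw [ha, funCalc_eq_sum, Finset.sum_mul, Finset.sum_eq_single t]
        · rw [smul_mul_assoc, hs.idempotent]
        · intro s _ hst; rw [smul_mul_assoc, hs.orthogonal s t hst, smul_zero]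
        · intro hn; exact absurd ht hn
      have ht0 : 0 < t := hβ.trans_le (hB.le ht)
      rw [map_smul, flow_eigenvector h2, smul_smul]
      have : 2 * 1 * (-(1 / 2) * Real.log t) = -Real.log t := by ring
      rw [this, Real.exp_neg, Real.exp_log ht0, mul_inv_cancel₀ ht0.ne', one_smul]
    have h3 : B = ∑ t ∈ (spectral B).support, t • spectral B t :=
      (spectral_isSpectralDecomposition B).eq_sum
    conv_lhs => rw [h3]
    rw [map_sum, Finset.sum_congr rfl h1, sum_spectral]
  · have e1 : negStep = fun t => 2⁻¹ * (1 - Real.sign t) := by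
      ext t; rw [negStep]; ring
    rw [e1, trFun_const_mul, trFun_const_mul, trFun_sub, trFun_sub, trFun_const, trFun_const,
      trFun_sign_flow]
  · obtain ⟨m, hm, h⟩ := exists_atLeast_flow a hδ hy 1
    exact hm.trans_le ((h 1 (by simp)).le ht)

lemma hasDerivAt_trFun_add_smul_one {f f' : ℝ → ℝ} {x : V} {r : ℝ}
    (h : ∀ t ∈ (spectral x).support, HasDerivAt f (f' (t + r)) (t + r)) :
    HasDerivAt (fun r : ℝ => trFun f (x + r • 1)) (trFun f' (x + r • 1)) r := by
  simp_rw [trFun_add_smul_one, trFun_eq_sum]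
  refine HasDerivAt.fun_sum fun t ht => HasDerivAt.mul_const ?_ _
  exact (h t ht).comp_const_add t r

/-- The trace function `tr (x log x - x)`. -/
noncomputable def trEta (x : V) : ℝ := trFun (fun t => t * Real.log t - t) x

lemma abs_trEta_sub_le {δ : ℝ} (hδ : 0 < δ) {x y : V} (hx : AtLeast δ x) (hy : AtLeast δ y) :
    |trEta x - trEta y - inner ℝ (log y) (x - y)| ≤ (1 / δ) * ‖x - y‖ ^ 2 :=
  abs_trFun_sub_le fun _ hs _ ht => abs_mul_log_sub_taylor_le hδ (hx.le hs) (hy.le ht)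

lemma hasDerivAt_trEta_add {δ r : ℝ} (hδ : 0 < δ) {x : V} (hx : AtLeast δ x) (hr : 0 ≤ r) :
    HasDerivAt (fun r : ℝ => trEta (x + r • 1)) (trFun Real.log (x + r • 1)) r := by
  refine hasDerivAt_trFun_add_smul_one fun t ht => ?_
  have : t + r ≠ 0 := by linarith [hx.le ht]
  simpa using (Real.hasDerivAt_mul_log this).fun_sub (hasDerivAt_id' (t + r))

/-- A mixed difference of `trEta` along the line `A + z B`. -/
noncomputable def etaDiff (Z h : ℝ) (A B : V) : ℝ :=
  trEta (A + (Z + h) • B) - trEta (A + Z • B) - trEta (A + h • B) + trEta A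

/-- Expand at A + r1, where the Taylor constant is 1/r. The linear terms cancel because (Z + h) - Z
- h = 0. -/
lemma tendsto_etaDiff_atTop {Z h α : ℝ} (hZ : 0 < Z) (hh : 0 < h) {A B : V} (hα : 0 < α)
    (hA : AtLeast α A) (hB : AtLeast 0 B) :
    Tendsto (fun r : ℝ => etaDiff Z h (A + r • 1) B) atTop (𝓝 0) := by
  have h1 : Tendsto (fun r : ℝ => 1 / r *
      (‖(Z + h) • B‖ ^ 2 + ‖Z • B‖ ^ 2 + ‖h • B‖ ^ 2)) atTop (𝓝 0) := by
    simpa using tendsto_inv_atTop_zero.mul_const (‖(Z + h) • B‖ ^ 2 + ‖Z • B‖ ^ 2 + ‖h • B‖ ^ 2)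
  refine squeeze_zero_norm' ?_ h1
  filter_upwards [eventually_gt_atTop 0] with r hr
  have hA' : AtLeast r (A + r • 1) :=
    (hA.add (atLeast_smul_one r)).mono (by linarith)
  have key : ∀ z : ℝ, 0 ≤ z → |trEta (A + r • 1 + z • B) - trEta (A + r • 1) -
      z * inner ℝ (log (A + r • 1)) B| ≤ 1 / r * ‖z • B‖ ^ 2 := fun z hz => by
    have h2 : AtLeast r (A + r • 1 + z • B) := by simpa using hA'.add (hB.smul hz)
    have h3 := abs_trEta_sub_le hr h2 hA'
    rwa [add_sub_cancel_left, inner_smul_right] at h3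
  have k1 := abs_le.mp (key (Z + h) (by positivity))
  have k2 := abs_le.mp (key Z hZ.le)
  have k3 := abs_le.mp (key h hh.le)
  rw [Real.norm_eq_abs, etaDiff, abs_le]
  constructor <;> linarith [k1.1, k1.2, k2.1, k2.2, k3.1, k3.2]

/-- The integral formula behind joint convexity. -/
theorem etaDiff_eq_lintegral {Z h α β : ℝ} (hZ : 0 < Z) (hh : 0 < h) {A B : V} (hα : 0 < α)
    (hA : AtLeast α A) (hβ : 0 < β) (hB : AtLeast β B) :
    0 ≤ etaDiff Z h A B ∧ ENNReal.ofReal (etaDiff Z h A B) =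
      ∫⁻ c in Set.Ioi 0, ENNReal.ofReal (logKernelDensity Z h c * trNeg (A - c • B)) := by
  obtain ⟨P, κ, hPB, hPstep, hPlog⟩ := exists_congruence hβ hB
  have hB0 := hB.mono hβ.le
  have hz : ∀ z : ℝ, 0 ≤ z → AtLeast α (A + z • B) := fun z hz => by
    simpa using hA.add (hB0.smul hz)
  have hzr : ∀ z : ℝ, 0 ≤ z → ∀ r : ℝ, 0 ≤ r → AtLeast α (A + z • B + r • 1) := fun z hz' r hr =>
    ((hz z hz').add (atLeast_smul_one r)).mono (by linarith)
  have hAr : ∀ r : ℝ, 0 ≤ r → AtLeast α (A + r • 1) := fun r hr =>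
    (hA.add (atLeast_smul_one r)).mono (by linarith)
  -- Since P B = 1, adding zB becomes adding z to every eigenvalue of P(A + r1).
  have hlog : ∀ r : ℝ, 0 ≤ r → ∀ z : ℝ, 0 ≤ z →
      trFun Real.log (A + z • B + r • 1) =
        trFun (fun t => Real.log (t + z)) (P (A + r • 1)) - κ := fun r hr z hz' => by
    have e : P (A + z • B + r • 1) = P (A + r • 1) + z • 1 := by
      rw [← hPB, ← map_smul P z B, ← map_add, hPB, add_right_comm]
    rw [← trFun_add_smul_one, ← e, (hPlog _ α hα (hzr z hz' r hr)).2]; ring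
  have hder : ∀ r ∈ Set.Ici (0 : ℝ), HasDerivAt (fun r : ℝ => etaDiff Z h (A + r • 1) B)
      (-trFun (logKernel Z h) (P (A + r • 1))) r := fun r hr => by
    have e : ∀ z : ℝ, 0 ≤ z → HasDerivAt (fun r : ℝ => trEta (A + r • 1 + z • B))
        (trFun (fun t => Real.log (t + z)) (P (A + r • 1)) - κ) r := fun z hz' => by
      have := hasDerivAt_trEta_add hα (hz z hz') hr
      rw [hlog r hr z hz'] at this
      simpa only [add_right_comm] using this
    have e0 := e 0 le_rfl
    simp only [zero_smul, add_zero] at e0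
    have h1 := (((e (Z + h) (by positivity)).fun_sub (e Z hZ.le)).fun_sub (e h hh.le)).fun_add e0
    have e4 : logKernel Z h = fun t => Real.log (t + Z) + Real.log (t + h) - Real.log t -
      Real.log (t + (Z + h)) := rfl
    have e5 : -trFun (logKernel Z h) (P (A + r • 1)) =
        (trFun (fun t => Real.log (t + (Z + h))) (P (A + r • 1)) - κ) -
          (trFun (fun t => Real.log (t + Z)) (P (A + r • 1)) - κ) -
          (trFun (fun t => Real.log (t + h)) (P (A + r • 1)) - κ) +
          (trFun (fun t => Real.log t) (P (A + r • 1)) - κ) := by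
      rw [e4, trFun_sub, trFun_sub, trFun_add]
      ring
    rw [e5]
    exact h1
  have hmain := setLIntegral_Ioi_of_hasDerivAt_neg (a := 0) hder
    (fun r hr => trFun_nonneg fun t ht => logKernel_nonneg hZ hh
      ((hPlog _ α hα (hAr r (le_of_lt hr))).1 t ht))
    (tendsto_etaDiff_atTop hZ hh hα hA hB0)
  simp only [zero_smul, add_zero] at hmain
  refine ⟨hmain.1, ?_⟩
  rw [← hmain.2]
  -- Working with nonnegative extended integrals, the exchange of r and c needs measurability only.
  have hmeas : Measurable (Function.uncurry fun c r : ℝ =>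
      ENNReal.ofReal (logKernelDensity Z h c) *
        ENNReal.ofReal (trFun negStep (A - c • B + r • 1))) := by
    refine ((measurable_logKernelDensity Z h).comp measurable_fst).ennreal_ofReal.mul
      (Measurable.ennreal_ofReal ?_)
    exact measurable_trFun_negStep (F := fun p : ℝ × ℝ => A - p.1 • B + p.2 • 1) (by fun_prop)
  calc ∫⁻ r in Set.Ioi (0 : ℝ), ENNReal.ofReal (trFun (logKernel Z h) (P (A + r • 1)))
      = ∫⁻ r in Set.Ioi 0, ∫⁻ c in Set.Ioi 0, ENNReal.ofReal (logKernelDensity Z h c) *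
          ENNReal.ofReal (trFun negStep (A - c • B + r • 1)) := by
        refine setLIntegral_congr_fun measurableSet_Ioi fun r hr => ?_
        rw [← lintegral_logKernelDensity_mul_trFun hZ hh
          (hPlog _ α hα (hAr r (le_of_lt hr))).1]
        refine setLIntegral_congr_fun measurableSet_Ioi fun c hc => ?_
        -- Shifting by c after P amounts to subtracting cB before P, which P-invariance of `trFun
        -- negStep` then exploits.
        have e : P (A + r • 1) - c • 1 = P (A - c • B + r • 1) := by
          rw [← hPB, ← map_smul P c B, ← map_sub, hPB, sub_add_eq_add_sub]
        rw [ENNReal.ofReal_mul (logKernelDensity_nonneg hZ hh hc), e, hPstep]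
    _ = ∫⁻ c in Set.Ioi 0, ∫⁻ r in Set.Ioi 0, ENNReal.ofReal (logKernelDensity Z h c) *
          ENNReal.ofReal (trFun negStep (A - c • B + r • 1)) :=
        (lintegral_lintegral_swap hmeas.aemeasurable).symm
    _ = _ := by
        refine setLIntegral_congr_fun measurableSet_Ioi fun c hc => ?_
        rw [ENNReal.ofReal_mul (logKernelDensity_nonneg hZ hh hc), ← lintegral_trFun_negStep_add,
          lintegral_const_mul]
        exact (measurable_trFun_negStep (F := fun r : ℝ => A - c • B + r • 1)
          (by fun_prop)).ennreal_ofReal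

/-- The mixed difference is jointly convex. -/
theorem etaDiff_sum_le {ι : Type*} (s : Finset ι) {p : ι → ℝ} (hp : ∀ i ∈ s, 0 ≤ p i)
    (hp1 : ∑ i ∈ s, p i = 1) {Z h δ : ℝ} (hZ : 0 < Z) (hh : 0 < h) (hδ : 0 < δ) {A B : ι → V}
    (hA : ∀ i, AtLeast δ (A i)) (hB : ∀ i, AtLeast δ (B i)) :
    etaDiff Z h (∑ i ∈ s, p i • A i) (∑ i ∈ s, p i • B i) ≤
      ∑ i ∈ s, p i * etaDiff Z h (A i) (B i) := by
  have hi := fun i => etaDiff_eq_lintegral hZ hh hδ (hA i) hδ (hB i)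
  have hbar := etaDiff_eq_lintegral hZ hh hδ (atLeast_convex_combination s hp hp1 hA) hδ
    (atLeast_convex_combination s hp hp1 hB)
  have hnn : ∀ i ∈ s, 0 ≤ p i * etaDiff Z h (A i) (B i) := fun i his =>
    mul_nonneg (hp i his) (hi i).1
  rw [← ENNReal.ofReal_le_ofReal_iff (Finset.sum_nonneg hnn), hbar.2,
    ENNReal.ofReal_sum_of_nonneg hnn]
  have hmeas : ∀ i, Measurable fun c : ℝ =>
      ENNReal.ofReal (logKernelDensity Z h c * trNeg (A i - c • B i)) := fun i => by
    refine ((measurable_logKernelDensity Z h).mul ?_).ennreal_ofReal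
    exact (continuous_trNeg.comp (by fun_prop : Continuous fun c : ℝ => A i - c • B i)).measurable
  have hsum : ∑ i ∈ s, ENNReal.ofReal (p i * etaDiff Z h (A i) (B i)) =
      ∫⁻ c in Set.Ioi 0, ∑ i ∈ s, ENNReal.ofReal (p i) *
        ENNReal.ofReal (logKernelDensity Z h c * trNeg (A i - c • B i)) := by
    rw [lintegral_finsetSum _ fun i _ => (hmeas i).const_mul _]
    refine Finset.sum_congr rfl fun i his => ?_
    rw [lintegral_const_mul _ (hmeas i), ← (hi i).2, ENNReal.ofReal_mul (hp i his)]
  rw [hsum]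
  refine setLIntegral_mono' measurableSet_Ioi fun c hc => ?_
  have hk := logKernelDensity_nonneg hZ hh hc
  have e : ∀ i ∈ s, ENNReal.ofReal (p i) *
      ENNReal.ofReal (logKernelDensity Z h c * trNeg (A i - c • B i)) =
      ENNReal.ofReal (p i * (logKernelDensity Z h c * trNeg (A i - c • B i))) := fun i his =>
    (ENNReal.ofReal_mul (hp i his)).symm
  rw [Finset.sum_congr rfl e, ← ENNReal.ofReal_sum_of_nonneg fun i his =>
    mul_nonneg (hp i his) (mul_nonneg hk (trNeg_nonneg _))]
  refine ENNReal.ofReal_le_ofReal ?_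
  have e2 : ∑ i ∈ s, p i • A i - c • ∑ i ∈ s, p i • B i = ∑ i ∈ s, p i • (A i - c • B i) := by
    rw [Finset.smul_sum, ← Finset.sum_sub_distrib]
    exact Finset.sum_congr rfl fun i _ => by rw [smul_sub, smul_comm]
  rw [e2]
  refine (mul_le_mul_of_nonneg_left (trNeg_sum_le s hp hp1 _) hk).trans (le_of_eq ?_)
  rw [Finset.mul_sum]
  exact Finset.sum_congr rfl fun i _ => by ring

end IntegralFormula

end EuclideanJordanAlgebra

namespace EuclideanJordanAlgebra

/-! ### From mixed differences to relative entropy, and the boundary of the cone. -/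

section RelativeEntropy

variable {V : Type*} [EuclideanJordanAlgebra V]

/-- The value of the relative entropy when it is finite. -/
noncomputable def finiteEntropy (ρ σ : V) : ℝ := inner ℝ ρ (log ρ) - inner ℝ ρ (log σ)

lemma tr_mul_log_sub (ρ σ : V) : tr (ρ * log ρ - ρ * log σ) = finiteEntropy ρ σ := by
  rw [finiteEntropy, ← tr_mul, ← tr_mul, tr, inner_sub_left, tr, tr]

lemma trEta_smul {Z : ℝ} (hZ : 0 < Z) (x : V) :
    trEta (Z • x) = Z * trEta x + Z * Real.log Z * tr x := by
  rw [trEta, trFun_smul _ _ hZ.ne', trEta, ← trFun_const_mul, ← trFun_id x, ← trFun_const_mul,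
    ← trFun_add]
  refine trFun_congr fun t _ => ?_
  rcases eq_or_ne t 0 with rfl | ht
  · simp
  · rw [Real.log_mul hZ.ne' ht]; ring

lemma abs_trEta_add_smul_sub_le {δ ε : ℝ} (hδ : 0 < δ) (hε : 0 ≤ ε) {x u : V} (hx : AtLeast δ x)
    (hu : AtLeast 0 u) :
    |trEta (x + ε • u) - trEta x - ε * inner ℝ (log x) u| ≤ ε ^ 2 * ((1 / δ) * ‖u‖ ^ 2) := by
  have h := abs_trEta_sub_le hδ (by simpa using hx.add (hu.smul hε)) hx
  rw [add_sub_cancel_left, inner_smul_right, norm_smul, mul_pow, Real.norm_eq_abs, sq_abs] at h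
  linarith

/-- The limit of `etaDiff Z h σ ρ - h * log Z * tr ρ` as `Z` tends to infinity. -/
noncomputable def etaDiffLim (h : ℝ) (σ ρ : V) : ℝ :=
  h * inner ℝ (log ρ) ρ - trEta (σ + h • ρ) + trEta σ

/-- Scale Z out of both large arguments by `trEta_smul` and expand at ρ to first order in 1/Z. The Z
log Z terms leave exactly h log Z tr ρ, and the error is O(1/Z). -/
lemma tendsto_etaDiff {δ h : ℝ} (hδ : 0 < δ) (hh : 0 < h) {σ ρ : V} (hσ : AtLeast δ σ)
    (hρ : AtLeast δ ρ) :
    Tendsto (fun Z => etaDiff Z h σ ρ - h * Real.log Z * tr ρ) atTop (𝓝 (etaDiffLim h σ ρ)) := by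
  rw [tendsto_iff_norm_sub_tendsto_zero]
  set C := (1 / δ) * ‖σ + h • ρ‖ ^ 2 + (1 / δ) * ‖σ‖ ^ 2
  have h1 : Tendsto (fun Z : ℝ => Z⁻¹ * C) atTop (𝓝 0) := by
    simpa using tendsto_inv_atTop_zero.mul_const C
  refine squeeze_zero' (Eventually.of_forall fun _ => norm_nonneg _) ?_ h1
  filter_upwards [eventually_gt_atTop 0] with Z hZ
  have hσ0 := hσ.mono hδ.le
  have hu : AtLeast 0 (σ + h • ρ) := by simpa using hσ0.add ((hρ.mono hδ.le).smul hh.le)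
  have hZi : 0 ≤ Z⁻¹ := by positivity
  have k1 := abs_le.mp (abs_trEta_add_smul_sub_le hδ hZi hρ hu)
  have k2 := abs_le.mp (abs_trEta_add_smul_sub_le hδ hZi hρ hσ0)
  have e1 : σ + (Z + h) • ρ = Z • (ρ + Z⁻¹ • (σ + h • ρ)) := by
    rw [smul_add, smul_inv_smul₀ hZ.ne']; module
  have e2 : σ + Z • ρ = Z • (ρ + Z⁻¹ • σ) := by
    rw [smul_add, smul_inv_smul₀ hZ.ne']; module
  have et : tr (ρ + Z⁻¹ • (σ + h • ρ)) = tr (ρ + Z⁻¹ • σ) + Z⁻¹ * h * tr ρ := by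
    simp only [tr, inner_add_left, inner_smul_left, conj_trivial]; ring
  rw [inner_add_right, inner_smul_right] at k1
  set X := trEta (ρ + Z⁻¹ • (σ + h • ρ)) with hX
  set Y := trEta (ρ + Z⁻¹ • σ) with hY
  have e3 : etaDiff Z h σ ρ - h * Real.log Z * tr ρ - etaDiffLim h σ ρ =
      Z * ((X - trEta ρ - Z⁻¹ * (inner ℝ (log ρ) σ + h * inner ℝ (log ρ) ρ)) -
        (Y - trEta ρ - Z⁻¹ * inner ℝ (log ρ) σ)) := by
    rw [etaDiff, etaDiffLim, e1, e2, trEta_smul hZ, trEta_smul hZ, et, ← hX, ← hY]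
    field_simp
    ring
  rw [e3, Real.norm_eq_abs, abs_mul, abs_of_pos hZ]
  have e4 : Z⁻¹ * C = Z * (Z⁻¹ ^ 2 * C) := by field_simp
  rw [e4]
  refine mul_le_mul_of_nonneg_left ?_ hZ.le
  rw [abs_le]
  constructor <;> linarith [k1.1, k1.2, k2.1, k2.2]

/-- The derivative of `trEta` at σ in the direction ρ is ⟨log σ, ρ⟩. -/
lemma tendsto_etaDiffLim {δ : ℝ} (hδ : 0 < δ) {σ ρ : V} (hσ : AtLeast δ σ) (hρ : AtLeast δ ρ) :
    Tendsto (fun h => h⁻¹ * etaDiffLim h σ ρ) (𝓝[>] 0) (𝓝 (finiteEntropy ρ σ)) := by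
  rw [tendsto_iff_norm_sub_tendsto_zero]
  set C := (1 / δ) * ‖ρ‖ ^ 2
  have h1 : Tendsto (fun h : ℝ => h * C) (𝓝[>] 0) (𝓝 0) := by
    have : Tendsto (fun h : ℝ => h * C) (𝓝 0) (𝓝 (0 * C)) :=
      (continuous_id.mul continuous_const).tendsto 0
    rw [zero_mul] at this
    exact this.mono_left nhdsWithin_le_nhds
  refine squeeze_zero' (Eventually.of_forall fun _ => norm_nonneg _) ?_ h1
  filter_upwards [self_mem_nhdsWithin] with h hh
  have hh : 0 < h := hh
  have k := abs_trEta_add_smul_sub_le hδ hh.le hσ (hρ.mono hδ.le)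
  have e : h⁻¹ * etaDiffLim h σ ρ - finiteEntropy ρ σ =
      -(h⁻¹ * (trEta (σ + h • ρ) - trEta σ - h * inner ℝ (log σ) ρ)) := by
    rw [etaDiffLim, finiteEntropy, real_inner_comm ρ (log ρ), real_inner_comm ρ (log σ)]
    field_simp
    ring
  rw [e, Real.norm_eq_abs, abs_neg, abs_mul, abs_of_pos (inv_pos.mpr hh)]
  have e2 : h * C = h⁻¹ * (h ^ 2 * C) := by field_simp
  rw [e2]
  exact mul_le_mul_of_nonneg_left k (inv_pos.mpr hh).le

/-- Joint convexity of the relative entropy on the interior of the cone. -/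
theorem finiteEntropy_sum_le {ι : Type*} (s : Finset ι) {p : ι → ℝ} (hp : ∀ i ∈ s, 0 ≤ p i)
    (hp1 : ∑ i ∈ s, p i = 1) {δ : ℝ} (hδ : 0 < δ) {ρ σ : ι → V}
    (hρ : ∀ i, AtLeast δ (ρ i)) (hσ : ∀ i, AtLeast δ (σ i)) :
    finiteEntropy (∑ i ∈ s, p i • ρ i) (∑ i ∈ s, p i • σ i) ≤
      ∑ i ∈ s, p i * finiteEntropy (ρ i) (σ i) := by
  have havg : ∀ A : ι → V, (∀ i, AtLeast δ (A i)) → AtLeast δ (∑ i ∈ s, p i • A i) :=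
    fun _ hA => atLeast_convex_combination s hp hp1 hA
  have htr : tr (∑ i ∈ s, p i • ρ i) = ∑ i ∈ s, p i * tr (ρ i) := by
    simp only [tr, sum_inner, inner_smul_left, conj_trivial]
  have hlim : ∀ h, 0 < h → etaDiffLim h (∑ i ∈ s, p i • σ i) (∑ i ∈ s, p i • ρ i) ≤
      ∑ i ∈ s, p i * etaDiffLim h (σ i) (ρ i) := fun h hh => by
    refine le_of_tendsto_of_tendsto (tendsto_etaDiff hδ hh (havg σ hσ) (havg ρ hρ))
      (tendsto_finsetSum s fun i _ => (tendsto_etaDiff hδ hh (hσ i) (hρ i)).const_mul (p i)) ?_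
    filter_upwards [eventually_gt_atTop 0] with Z hZ
    have := etaDiff_sum_le s hp hp1 hZ hh hδ hσ hρ
    simp only [mul_sub, Finset.sum_sub_distrib]
    -- The subtracted terms h log Z tr ρ agree on both sides by linearity.
    rw [htr, Finset.mul_sum]
    refine sub_le_sub this (le_of_eq (Finset.sum_congr rfl fun i _ => by ring))
  refine le_of_tendsto_of_tendsto (tendsto_etaDiffLim hδ (havg σ hσ) (havg ρ hρ))
    (tendsto_finsetSum s fun i _ => (tendsto_etaDiffLim hδ (hσ i) (hρ i)).const_mul (p i)) ?_
  filter_upwards [self_mem_nhdsWithin] with h hh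
  have hh : 0 < h := hh
  refine (mul_le_mul_of_nonneg_left (hlim h hh) (inv_pos.mpr hh).le).trans (le_of_eq ?_)
  rw [Finset.mul_sum]
  exact Finset.sum_congr rfl fun i _ => by ring

lemma funCalc_shift (f : ℝ → ℝ) (x : V) (ε : ℝ) :
    funCalc f (x + ε • 1) = funCalc (fun t => f (t + ε)) x := by
  rw [← funCalc_add_smul_one, funCalc_funCalc f (add_left_injective ε)]

lemma tendsto_inner_log_self (ρ : V) :
    Tendsto (fun ε : ℝ => inner ℝ (ρ + ε • 1) (log (ρ + ε • 1))) (𝓝[>] 0)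
      (𝓝 (inner ℝ ρ (log ρ))) := by
  have e : ∀ x : V, inner ℝ x (log x) = trFun (fun t => t * Real.log t) x := fun x => by
    rw [← tr_mul, log, mul_funCalc, trFun]
  simp_rw [e, trFun_add_smul_one]
  refine tendsto_trFun (fun t => ?_) ρ
  have h : Continuous fun ε : ℝ => (t + ε) * Real.log (t + ε) :=
    Real.continuous_mul_log.comp (continuous_const.add continuous_id)
  have := h.tendsto 0
  rw [add_zero] at this
  exact this.mono_left nhdsWithin_le_nhds

lemma inner_add_log_add (ρ σ : V) (ε : ℝ) :
    inner ℝ (ρ + ε • 1) (log (σ + ε • 1)) =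
      ∑ t ∈ (spectral σ).support, Real.log (t + ε) * inner ℝ ρ (spectral σ t) +
        ∑ t ∈ (spectral σ).support, ε * Real.log (t + ε) * tr (spectral σ t) := by
  rw [log, funCalc_shift, funCalc_eq_sum, inner_sum, ← Finset.sum_add_distrib]
  refine Finset.sum_congr rfl fun t _ => ?_
  rw [inner_smul_right, inner_add_left, inner_smul_left, conj_trivial, tr,
    real_inner_comm (1 : V)]
  ring

lemma tendsto_mul_log_add {t : ℝ} (ht : 0 ≤ t) :
    Tendsto (fun ε : ℝ => ε * Real.log (t + ε)) (𝓝[>] 0) (𝓝 0) := by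
  rcases ht.eq_or_lt with rfl | ht
  · simpa using (Real.continuous_mul_log.tendsto 0).mono_left
      (nhdsWithin_le_nhds (s := Set.Ioi (0 : ℝ)))
  · have h : ContinuousAt (fun ε : ℝ => ε * Real.log (t + ε)) 0 := by
      refine continuousAt_id.mul (ContinuousAt.log (by fun_prop) (by simpa using ht.ne'))
    simpa using h.tendsto.mono_left (nhdsWithin_le_nhds (s := Set.Ioi (0 : ℝ)))

lemma tendsto_log_add {t : ℝ} (ht : t ≠ 0) :
    Tendsto (fun ε : ℝ => Real.log (t + ε)) (𝓝[>] 0) (𝓝 (Real.log t)) := by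
  have h : ContinuousAt (fun ε : ℝ => Real.log (t + ε)) 0 :=
    ContinuousAt.log (by fun_prop) (by simpa using ht)
  simpa using h.tendsto.mono_left (nhdsWithin_le_nhds (s := Set.Ioi (0 : ℝ)))

lemma tendsto_sum_mul_log_add {σ : V} (hσ : AtLeast 0 σ) :
    Tendsto (fun ε : ℝ =>
      ∑ t ∈ (spectral σ).support, ε * Real.log (t + ε) * tr (spectral σ t)) (𝓝[>] 0) (𝓝 0) := by
  have := tendsto_finsetSum (spectral σ).support fun t ht =>
    (tendsto_mul_log_add (hσ.le ht)).mul_const (tr (spectral σ t))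
  simpa using this

lemma tendsto_finiteEntropy {ρ σ : V} (hσ : AtLeast 0 σ) (h0 : tr (ρ * spectral σ 0) = 0) :
    Tendsto (fun ε : ℝ => finiteEntropy (ρ + ε • 1) (σ + ε • 1)) (𝓝[>] 0)
      (𝓝 (finiteEntropy ρ σ)) := by
  refine (tendsto_inner_log_self ρ).sub ?_
  simp_rw [inner_add_log_add]
  rw [tr_mul] at h0
  have e : inner ℝ ρ (log σ) =
      ∑ t ∈ (spectral σ).support, Real.log t * inner ℝ ρ (spectral σ t) := by
    simp only [log, funCalc_eq_sum, inner_sum, inner_smul_right]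
  rw [e, ← add_zero (∑ t ∈ (spectral σ).support, _)]
  refine (tendsto_finsetSum _ fun t _ => ?_).add (tendsto_sum_mul_log_add hσ)
  rcases eq_or_ne t 0 with rfl | ht
  · simp [h0]
  · exact (tendsto_log_add ht).mul_const _

/-- The kernel of σ contributes -log ε times the positive weight ⟨ρ, c₀⟩; all other terms stay
bounded. -/
lemma tendsto_finiteEntropy_atTop {ρ σ : V} (hρ : AtLeast 0 ρ) (hσ : AtLeast 0 σ)
    (h0 : tr (ρ * spectral σ 0) ≠ 0) :
    Tendsto (fun ε : ℝ => finiteEntropy (ρ + ε • 1) (σ + ε • 1)) (𝓝[>] 0) atTop := by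
  rw [tr_mul] at h0
  have hpos : 0 < inner ℝ ρ (spectral σ 0) :=
    lt_of_le_of_ne (by simpa using hρ _ (spectral_mul_self σ 0)) h0.symm
  have hmem : (0 : ℝ) ∈ (spectral σ).support := by
    rw [Finsupp.mem_support_iff]
    intro h
    rw [h, inner_zero_right] at h0
    exact h0 rfl
  have h1 : Tendsto (fun ε : ℝ => -∑ t ∈ (spectral σ).support,
      Real.log (t + ε) * inner ℝ ρ (spectral σ t)) (𝓝[>] 0) atTop := by
    rw [tendsto_neg_atTop_iff]
    simp_rw [← Finset.add_sum_erase _ _ hmem, zero_add]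
    refine (Real.tendsto_log_nhdsGT_zero.atBot_mul_const hpos).atBot_add
      (tendsto_finsetSum _ fun t ht =>
        (tendsto_log_add (Finset.ne_of_mem_erase ht)).mul_const _)
  have h2 := (h1.atTop_add (tendsto_sum_mul_log_add hσ).neg).atTop_add (tendsto_inner_log_self ρ)
  refine h2.congr fun ε => ?_
  rw [finiteEntropy, inner_add_log_add ρ σ]
  ring

/-- Joint convexity of the relative entropy. -/
theorem relEntropy_sum_le {k : ℕ} {ρ σ : Fin k → V} (hρ : ∀ i, ρ i ∈ positiveCone V)
    (hσ : ∀ i, σ i ∈ positiveCone V) {p : Fin k → ℝ} (hp : ∀ i, 0 ≤ p i) (hp1 : ∑ i, p i = 1) :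
    relEntropy (∑ i, p i • ρ i) (∑ i, p i • σ i) ≤
      ∑ i, ((p i : ℝ) : EReal) * relEntropy (ρ i) (σ i) := by
  have hρ0 : ∀ i, AtLeast 0 (ρ i) := fun i => atLeast_of_mem_positiveCone (hρ i)
  have hσ0 : ∀ i, AtLeast 0 (σ i) := fun i => atLeast_of_mem_positiveCone (hσ i)
  by_cases hfin : ∀ i, p i = 0 ∨ tr (ρ i * spectral (σ i) 0) = 0
  · have hterm : ∀ i, ((p i : ℝ) : EReal) * relEntropy (ρ i) (σ i) =
        ((p i * finiteEntropy (ρ i) (σ i) : ℝ) : EReal) := fun i => by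
      rcases hfin i with h | h
      · simp [h]
      · rw [relEntropy, if_pos h, tr_mul_log_sub, EReal.coe_mul]
    have hconv : ∀ᶠ ε : ℝ in 𝓝[>] 0,
        finiteEntropy (∑ i, p i • ρ i + ε • 1) (∑ i, p i • σ i + ε • 1) ≤
          ∑ i, p i * finiteEntropy (ρ i + ε • 1) (σ i + ε • 1) := by
      filter_upwards [self_mem_nhdsWithin] with ε hε
      have hpos : ∀ A : Fin k → V, (∀ i, AtLeast 0 (A i)) → ∀ i, AtLeast ε (A i + ε • 1) :=
        fun A hA i => by simpa using (hA i).add (atLeast_smul_one ε)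
      have := finiteEntropy_sum_le Finset.univ (fun i _ => hp i) hp1 hε (hpos ρ hρ0) (hpos σ hσ0)
      simpa only [smul_add, Finset.sum_add_distrib, ← Finset.sum_smul, hp1, one_smul] using this
    have hlim : Tendsto (fun ε : ℝ => ∑ i, p i * finiteEntropy (ρ i + ε • 1) (σ i + ε • 1)) (𝓝[>] 0)
        (𝓝 (∑ i, p i * finiteEntropy (ρ i) (σ i))) := by
      refine tendsto_finsetSum _ fun i _ => ?_
      rcases hfin i with h | h
      · simp [h]
      · exact (tendsto_finiteEntropy (hσ0 i) h).const_mul _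
    have havg : ∀ A : Fin k → V, (∀ i, AtLeast 0 (A i)) → AtLeast 0 (∑ i, p i • A i) :=
      fun _ hA => atLeast_convex_combination _ (fun i _ => hp i) hp1 hA
    -- If the averages violated the support condition, the regularized left side would diverge while
    -- its upper bound converges.
    have h0 : tr ((∑ i, p i • ρ i) * spectral (∑ i, p i • σ i) 0) = 0 := by
      by_contra hne
      exact not_tendsto_nhds_of_tendsto_atTop
        (tendsto_atTop_mono' _ hconv (tendsto_finiteEntropy_atTop (havg ρ hρ0) (havg σ hσ0) hne))
        _ hlim
    have hsum : ∑ i, ((p i : ℝ) : EReal) * relEntropy (ρ i) (σ i) =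
        ((∑ i, p i * finiteEntropy (ρ i) (σ i) : ℝ) : EReal) := by
      rw [Finset.sum_congr rfl fun i _ => hterm i]
      exact (map_sum (⟨⟨Real.toEReal, EReal.coe_zero⟩, EReal.coe_add⟩ : ℝ →+ EReal) _ _).symm
    rw [hsum, relEntropy, if_pos h0, tr_mul_log_sub, EReal.coe_le_coe_iff]
    exact le_of_tendsto_of_tendsto (tendsto_finiteEntropy (havg σ hσ0) h0) hlim hconv
  · push Not at hfin
    obtain ⟨i, hi, hne⟩ := hfin
    -- An infinite term forces the sum to be ⊤ only because no partial sum is ⊥, as ⊤ + ⊥ = ⊥ in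
    -- `EReal`.
    have hbot : ∀ s : Finset (Fin k),
        ∑ j ∈ s, ((p j : ℝ) : EReal) * relEntropy (ρ j) (σ j) ≠ ⊥ := fun s =>
      Finset.sum_induction _ (· ≠ ⊥) (fun a b ha hb => EReal.add_ne_bot_iff.mpr ⟨ha, hb⟩)
        EReal.zero_ne_bot fun j _ => by
          rw [relEntropy]
          split_ifs
          · rw [← EReal.coe_mul]; exact EReal.coe_ne_bot _
          · rcases (hp j).eq_or_lt with h | h
            · simp [← h]
            · rw [EReal.coe_mul_top_of_pos h]; exact top_ne_bot
    rw [← Finset.add_sum_erase _ (fun i => ((p i : ℝ) : EReal) * relEntropy (ρ i) (σ i))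
      (Finset.mem_univ i)]
    have htop : ((p i : ℝ) : EReal) * relEntropy (ρ i) (σ i) = ⊤ := by
      rw [relEntropy, if_neg hne, EReal.coe_mul_top_of_pos (lt_of_le_of_ne (hp i) (Ne.symm hi))]
    rw [htop, EReal.top_add_of_ne_bot (hbot _)]
    exact le_top

end RelativeEntropy

end EuclideanJordanAlgebra

theorem theorem4p4 {V : Type*} [EuclideanJordanAlgebra V] (k : ℕ) (ρ σ : Fin k → V)
    (hρ : ∀ i, EuclideanJordanAlgebra.IsState (ρ i))
    (hσ : ∀ i, EuclideanJordanAlgebra.IsState (σ i))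
    (p : Fin k → ℝ) (hp : ∀ i, 0 ≤ p i) (hp1 : ∑ i, p i = 1) :
    EuclideanJordanAlgebra.relEntropy (∑ i, p i • ρ i) (∑ i, p i • σ i) ≤
      ∑ i, ((p i : ℝ) : EReal) * EuclideanJordanAlgebra.relEntropy (ρ i) (σ i) := by
  exact EuclideanJordanAlgebra.relEntropy_sum_le (fun i => (hρ i).1) (fun i => (hσ i).1) hp hp1
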